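/- Setting. Let $M$ be a smooth manifold of dimension $2n+1$ with an almost contact metric structure $(\varphi,\xi,\eta,g)$: $\varphi$ is a $(1,1)$-tensor field, $\xi$ a vector field, $\eta$ a 1-form and $g$ a Riemannian metric (all smooth) with $\varphi^2=-\mathrm{id}+\eta\otimes\xi$, $\varphi\xi=0$, $\eta\circ\varphi=0$, $g(\xi,\xi)=1$, $g(\varphi x,\varphi y)=g(x,y)-\eta(x)\eta(y)$. Let $\nabla$ be the Levi-Civita connection of $g$, $\Phi(x,y)=g(x,\varphi y)$, $F=-\nabla\Phi$, and, for an orthonormal basis $\{e_i\}$ of the tangent space, $f(z)=\sum_i F(e_i,e_i,z)$, $f^*(z)=\sum_i F(e_i,\varphi e_i,z)$, $\omega(z)=F(\xi,\xi,z)$. The Lee form is $\theta=\frac{f^*(\xi)}{2n}\,\eta+\frac1{2(n-1)}\,f\circ\varphi$ (for $n\ge 2$). Let $W_1$ be the class of those structures for which $F=\eta\otimes(\eta\wedge\omega)$, i.e. $F(x,y,z)=\eta(x)\,(\eta(y)\omega(z)-\eta(z)\omega(y))$. On $W_1$ the Lee form is a nonzero constant multiple of $\omega\circ\varphi$, and for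 any $n$ one may also take $\theta=\omega\circ\varphi$; everything below holds for both normalizations. Let $W_1^0\subset W_1$ be the subclass on which $\theta$ is closed, $d\theta=0$. For a bilinear form $L$ on a tangent space put $SL(x,y)=\frac12(L(x,y)+L(y,x))$, $AL(x,y)=\frac12(L(x,y)-L(y,x))$, $h=-\varphi^2$, $hL(x,y)=L(hx,hy)$, $(L\circ\varphi)(x,y)=L(\varphi x,\varphi y)$, $vL(x,y)=\eta(x)L(\xi,y)+\eta(y)L(x,\xi)-2\eta(x)\eta(y)L(\xi,\xi)$, $wL(x,y)=\eta(x)\eta(y)L(\xi,\xi)$, $\alpha=\sum_i hL(e_i,e_i)$, $\beta=\sum_i hL(e_i,\varphi e_i)$, and $$L_1(L)=\tfrac{\alpha}{2n}\,hg,\quad L_2(L)=\tfrac12[ShL+ShL\circ\varphi]-L_1(L),\quad L_3(L)=\tfrac12[ShL-ShL\circ\varphi],$$ $$L_4(L)(x,y)=-\tfrac{\beta}{2n}\,hg(x,\varphi y),\quad L_5(L)=\tfrac12[AhL+AhL\circ\varphi]-L_4(L),\quad L_6(L)=\tfrac12[AhL-AhL\circ\varphi],$$ $$L_7(L)=SvL,\quad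 L_8(L)=AvL,\quad L_9(L)=wL .$$ Let $\mathcal L_i=\{L: L=L_i(L)\}$. For a set $J\subset\{1,\dots,9\}$, $\bigoplus_{j\in J}\Omega_j$ denotes the set of (smooth) 1-forms $\theta$ whose covariant derivative $\nabla\theta$ lies in $\bigoplus_{j\in J}\mathcal L_j$ at every point, and $\bigoplus_{j\in J}W_{1j}$ denotes the class of those structures in $W_1$ whose Lee form belongs to $\bigoplus_{j\in J}\Omega_j$. Theorem 2. The subspaces $\mathcal L_1,\dots,\mathcal L_9$ are linearly independent, so that the sums are direct, and $$W_1=W_{11}\oplus W_{12}\oplus W_{13}\oplus W_{17}\oplus W_{18}\oplus W_{19},\qquad W_1^0=W_{11}\oplus W_{12}\oplus W_{13}\oplus W_{17}\oplus W_{19}.$$ -/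

import Mathlib

open Bundle
open scoped Manifold ContDiff

noncomputable section

set_option linter.unusedSectionVars false

/-! ## Almost contact metric vector spaces and tensors of type (0,2) -/

/-- An almost contact metric structure `(φ, ξ, η, g)` on a real vector space `V`. -/
structure AlmostContactMetric (V : Type*) [AddCommGroup V] [Module ℝ V] where
  φ : V →ₗ[ℝ] V
  ξ : V
  η : V →ₗ[ℝ] ℝ
  g : LinearMap.BilinForm ℝ V
  g_symm : ∀ x y, g x y = g y x
  g_pos : ∀ x, x ≠ 0 → 0 < g x x
  φ_φ : ∀ x, φ (φ x) = -x + η x • ξ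
  φ_ξ : φ ξ = 0
  η_φ : ∀ x, η (φ x) = 0
  g_ξ_ξ : g ξ ξ = 1
  g_φ_φ : ∀ x y, g (φ x) (φ y) = g x y - η x * η y

namespace AlmostContactMetric

section Algebra

variable {V : Type*} [AddCommGroup V] [Module ℝ V]

/-- The symmetric part `S L` of a bilinear form. -/
def symPart (L : LinearMap.BilinForm ℝ V) : LinearMap.BilinForm ℝ V :=
  (1 / 2 : ℝ) • (L + LinearMap.flip L)

/-- The antisymmetric part `A L` of a bilinear form. -/
def altPart (L : LinearMap.BilinForm ℝ V) : LinearMap.BilinForm ℝ V :=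
  (1 / 2 : ℝ) • (L - LinearMap.flip L)

theorem symPart_apply (L : LinearMap.BilinForm ℝ V) (x y : V) :
    symPart L x y = (L x y + L y x) / 2 := by
  simp [symPart]; ring

theorem altPart_apply (L : LinearMap.BilinForm ℝ V) (x y : V) :
    altPart L x y = (L x y - L y x) / 2 := by
  simp [altPart]; ring

variable (S : AlmostContactMetric V)

/-- The operator `h = -φ²` on `V`. -/
def hMap : V →ₗ[ℝ] V := -(S.φ ∘ₗ S.φ)

/-- `(h L)(x, y) = L(h x, h y)`. -/
def hPart (L : LinearMap.BilinForm ℝ V) : LinearMap.BilinForm ℝ V :=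
  L.compl₁₂ S.hMap S.hMap

/-- `(L ∘ φ)(x, y) = L(φ x, φ y)`. -/
def compφ (L : LinearMap.BilinForm ℝ V) : LinearMap.BilinForm ℝ V :=
  L.compl₁₂ S.φ S.φ

/-- `(v L)(x, y) = η(x) L(ξ, y) + η(y) L(x, ξ) - 2 η(x) η(y) L(ξ, ξ)`. -/
def vPart (L : LinearMap.BilinForm ℝ V) : LinearMap.BilinForm ℝ V :=
  S.η.smulRight (L S.ξ) + (LinearMap.flip L S.ξ).smulRight S.η
    - (2 * L S.ξ S.ξ) • S.η.smulRight S.η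

/-- `(w L)(x, y) = η(x) η(y) L(ξ, ξ)`. -/
def wPart (L : LinearMap.BilinForm ℝ V) : LinearMap.BilinForm ℝ V :=
  L S.ξ S.ξ • S.η.smulRight S.η

theorem hPart_apply (L : LinearMap.BilinForm ℝ V) (x y : V) :
    S.hPart L x y = L (S.hMap x) (S.hMap y) := rfl

theorem compφ_apply (L : LinearMap.BilinForm ℝ V) (x y : V) :
    S.compφ L x y = L (S.φ x) (S.φ y) := rfl

theorem vPart_apply (L : LinearMap.BilinForm ℝ V) (x y : V) :
    S.vPart L x y = S.η x * L S.ξ y + S.η y * L x S.ξ - 2 * S.η x * S.η y * L S.ξ S.ξ := by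
  simp [vPart]; ring

theorem wPart_apply (L : LinearMap.BilinForm ℝ V) (x y : V) :
    S.wPart L x y = S.η x * S.η y * L S.ξ S.ξ := by
  simp [wPart]; ring

/-- The bilinear form `h g`. -/
def hMetric : LinearMap.BilinForm ℝ V := S.hPart S.g

/-- The bilinear form `(x, y) ↦ h g(x, φ y)`. -/
def hMetricφ : LinearMap.BilinForm ℝ V := S.hMetric.compl₂ S.φ

theorem g_nondegenerate : S.g.Nondegenerate := by
  refine ⟨fun x hx => ?_, fun x hx => ?_⟩ <;>
  · by_contra h
    exact (S.g_pos x h).ne' (hx x)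

variable [FiniteDimensional ℝ V]

/-- The metric trace `∑ g(eⁱ, eʲ) B(eᵢ, eⱼ)` of a bilinear form `B`: the trace of the endomorphism
`T` with `g(T x, y) = B(x, y)`. -/
def metricTrace (B : LinearMap.BilinForm ℝ V) : ℝ :=
  LinearMap.trace ℝ V
    ((LinearMap.BilinForm.toDual S.g S.g_nondegenerate).symm.toLinearMap ∘ₗ B)

/-- Over an orthonormal basis the metric trace is `∑ B(eᵢ, eᵢ)`. -/
theorem metricTrace_eq_sum {ι : Type*} [Fintype ι] [DecidableEq ι] (e : Module.Basis ι ℝ V)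
    (he : ∀ i j, S.g (e i) (e j) = if i = j then 1 else 0) (B : LinearMap.BilinForm ℝ V) :
    S.metricTrace B = ∑ i, B (e i) (e i) := by
  have hcoord : ∀ (x : V) (i : ι), e.repr x i = S.g x (e i) := by
    intro x i
    have h : S.g x (e i) = S.g (∑ j, e.repr x j • e j) (e i) := by rw [e.sum_repr]
    rw [h]
    simp only [map_sum, map_smul, LinearMap.sum_apply, LinearMap.smul_apply, he]
    simp
  rw [metricTrace, LinearMap.trace_eq_matrix_trace ℝ e, Matrix.trace]
  refine Finset.sum_congr rfl fun i _ => ?_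
  rw [Matrix.diag_apply, LinearMap.toMatrix_apply, hcoord]
  simp

/-- The trace `α(L) = ∑ (h L)(eᵢ, eᵢ)` over an orthonormal basis. -/
def traceα (L : LinearMap.BilinForm ℝ V) : ℝ := S.metricTrace (S.hPart L)

/-- The trace `β(L) = ∑ (h L)(eᵢ, φ eᵢ)` over an orthonormal basis. -/
def traceβ (L : LinearMap.BilinForm ℝ V) : ℝ := S.metricTrace ((S.hPart L).compl₂ S.φ)

/-- The tensors `L₁(L), …, L₉(L)` associated with a tensor `L` of type (0,2) on an almost contact
metric vector space of dimension `2 n + 1`. The coefficients of the first and the fourth are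
normalized so that these tensors are the trace components of `L`:
`α(h g) = 2 n` and `β((x, y) ↦ h g(x, φ y)) = -2 n`. -/
def component (n : ℕ) (i : ℕ) (L : LinearMap.BilinForm ℝ V) : LinearMap.BilinForm ℝ V :=
  match i with
  | 1 => (S.traceα L / (2 * n)) • S.hMetric
  | 2 => (1 / 2 : ℝ) • (symPart (S.hPart L) + S.compφ (symPart (S.hPart L)))
      - (S.traceα L / (2 * n)) • S.hMetric
  | 3 => (1 / 2 : ℝ) • (symPart (S.hPart L) - S.compφ (symPart (S.hPart L)))
  | 4 => (-(S.traceβ L / (2 * n))) • S.hMetricφ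
  | 5 => (1 / 2 : ℝ) • (altPart (S.hPart L) + S.compφ (altPart (S.hPart L)))
      - (-(S.traceβ L / (2 * n))) • S.hMetricφ
  | 6 => (1 / 2 : ℝ) • (altPart (S.hPart L) - S.compφ (altPart (S.hPart L)))
  | 7 => symPart (S.vPart L)
  | 8 => altPart (S.vPart L)
  | 9 => S.wPart L
  | _ => 0

theorem traceα_add (L K : LinearMap.BilinForm ℝ V) :
    S.traceα (L + K) = S.traceα L + S.traceα K := by
  have h : S.hPart (L + K) = S.hPart L + S.hPart K := rfl
  simp [traceα, metricTrace, h, LinearMap.comp_add]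

theorem traceα_smul (c : ℝ) (L : LinearMap.BilinForm ℝ V) :
    S.traceα (c • L) = c * S.traceα L := by
  have h : S.hPart (c • L) = c • S.hPart L := rfl
  simp [traceα, metricTrace, h, LinearMap.comp_smul]

theorem traceβ_add (L K : LinearMap.BilinForm ℝ V) :
    S.traceβ (L + K) = S.traceβ L + S.traceβ K := by
  have h : (S.hPart (L + K)).compl₂ S.φ
      = (S.hPart L).compl₂ S.φ + (S.hPart K).compl₂ S.φ := rfl
  simp [traceβ, metricTrace, h, LinearMap.comp_add]

theorem traceβ_smul (c : ℝ) (L : LinearMap.BilinForm ℝ V) :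
    S.traceβ (c • L) = c * S.traceβ L := by
  have h : (S.hPart (c • L)).compl₂ S.φ = c • (S.hPart L).compl₂ S.φ := rfl
  simp [traceβ, metricTrace, h, LinearMap.comp_smul]

theorem component_add (n i : ℕ) (L K : LinearMap.BilinForm ℝ V) :
    S.component n i (L + K) = S.component n i L + S.component n i K := by
  refine LinearMap.ext₂ fun x y => ?_
  unfold component
  split <;> simp [symPart_apply, altPart_apply, hPart_apply, compφ_apply, vPart_apply,
    wPart_apply, traceα_add, traceβ_add] <;> ring

theorem component_smul (n i : ℕ) (c : ℝ) (L : LinearMap.BilinForm ℝ V) :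
    S.component n i (c • L) = c • S.component n i L := by
  refine LinearMap.ext₂ fun x y => ?_
  unfold component
  split <;> simp [symPart_apply, altPart_apply, hPart_apply, compφ_apply, vPart_apply,
    wPart_apply, traceα_smul, traceβ_smul] <;> ring

/-- The subspace `{L : L = Lᵢ(L)}` of the space of tensors of type (0,2), for `1 ≤ i ≤ 9`
(it is zero for all other `i`). -/
def tensorSubspace (n i : ℕ) : Submodule ℝ (LinearMap.BilinForm ℝ V) where
  carrier := {L | L = S.component n i L}
  add_mem' := by
    intro L K hL hK
    change L + K = _
    rw [component_add, ← (show L = _ from hL), ← (show K = _ from hK)]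
  zero_mem' := by
    have h := S.component_smul n i 0 0
    rw [zero_smul, zero_smul] at h
    exact h.symm
  smul_mem' := by
    intro c L hL
    change c • L = _
    rw [component_smul, ← (show L = _ from hL)]

end Algebra

end AlmostContactMetric

/-! ## Almost contact metric manifolds -/

section Manifold

variable {E : Type*} [NormedAddCommGroup E] [NormedSpace ℝ E]
  {M : Type*} [TopologicalSpace M] [ChartedSpace E M]

variable (E M) in
/-- A field of linear forms on the tangent spaces of `M`, with no regularity required. -/
abbrev FormField : Type _ := Π p : M, TangentSpace 𝓘(ℝ, E) p →L[ℝ] ℝ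

variable [IsManifold 𝓘(ℝ, E) ∞ M]

/-- The field of linear forms `θ` is a 1-form on `M`, i.e. it is smooth. -/
def FormField.IsOneForm (θ : FormField E M) : Prop :=
  ContMDiff 𝓘(ℝ, E) (𝓘(ℝ, E).prod 𝓘(ℝ, E →L[ℝ] ℝ)) ∞
    (fun p => TotalSpace.mk' (E →L[ℝ] ℝ)
      (E := fun p : M => TangentSpace 𝓘(ℝ, E) p →L[ℝ] ℝ) p (θ p))

/-- Differentiability of a field of linear forms at a point. -/
def FormField.DiffAt (θ : FormField E M) (p : M) : Prop :=
  MDifferentiableAt 𝓘(ℝ, E) (𝓘(ℝ, E).prod 𝓘(ℝ, E →L[ℝ] ℝ))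
    (fun q => TotalSpace.mk' (E →L[ℝ] ℝ)
      (E := fun q : M => TangentSpace 𝓘(ℝ, E) q →L[ℝ] ℝ) q (θ q)) p

/-- A 1-form `θ` is closed: `dθ(X, Y) = X θ(Y) - Y θ(X) - θ([X, Y])` vanishes at every point `p`
for all vector fields `X`, `Y` that are differentiable at `p`. -/
def FormField.IsClosedForm (θ : FormField E M) : Prop :=
  ∀ (p : M) (X Y : Π q : M, TangentSpace 𝓘(ℝ, E) q), MDiffAt (T% X) p → MDiffAt (T% Y) p →
    mvfderiv 𝓘(ℝ, E) (fun q => θ q (Y q)) p (X p) - mvfderiv 𝓘(ℝ, E) (fun q => θ q (X q)) p (Y p)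
      - θ p (VectorField.mlieBracket 𝓘(ℝ, E) X Y p) = 0

variable (E M) in
/-- A smooth Riemannian metric on `M`. -/
abbrev SmoothMetric : Type _ :=
  ContMDiffRiemannianMetric 𝓘(ℝ, E) ∞ E (fun p : M => TangentSpace 𝓘(ℝ, E) p)

variable (E M) in
/-- An affine connection on `M`; the covariant derivative `(∇_x Y)(p)` is `nabla Y p x`. -/
abbrev Connection : Type _ :=
  CovariantDerivative 𝓘(ℝ, E) E (fun p : M => TangentSpace 𝓘(ℝ, E) p)

variable [FiniteDimensional ℝ E]

/-- `nabla` is the Levi-Civita connection of `g`: the smooth, torsion-free affine connection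
which is compatible with `g`. -/
structure IsLeviCivita (g : SmoothMetric E M) (nabla : Connection E M) : Prop where
  smooth : CovariantDerivative.ContMDiffCovariantDerivative nabla ∞
  torsion : nabla.torsion = 0
  metric : ∀ (p : M) (Y Z : Π q : M, TangentSpace 𝓘(ℝ, E) q),
    MDiffAt (T% Y) p → MDiffAt (T% Z) p → ∀ x : TangentSpace 𝓘(ℝ, E) p,
      mvfderiv 𝓘(ℝ, E) (fun q => g.inner q (Y q) (Z q)) p x
        = g.inner p (nabla Y p x) (Z p) + g.inner p (Y p) (nabla Z p x)

/-- The tangent spaces of `M` are finite-dimensional. -/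
instance tangentSpace_finiteDimensional (p : M) :
    FiniteDimensional ℝ (TangentSpace 𝓘(ℝ, E) p) :=
  inferInstanceAs (FiniteDimensional ℝ E)

instance tangentSpace_t2Space (p : M) : T2Space (TangentSpace 𝓘(ℝ, E) p) :=
  inferInstanceAs (T2Space E)

theorem tensorialAt_nablaForm (nabla : Connection E M) (θ : FormField E M) (p : M)
    (hθ : θ.DiffAt p) :
    TensorialAt 𝓘(ℝ, E) E
      (fun Y : Π q : M, TangentSpace 𝓘(ℝ, E) q =>
        mvfderiv 𝓘(ℝ, E) (fun q => θ q (Y q)) p - θ p ∘L nabla Y p) p := by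
  have h : ∀ {Y : Π q : M, TangentSpace 𝓘(ℝ, E) q}, MDiffAt (T% Y) p →
      MDiffAt (fun q => θ q (Y q)) p := by
    intro Y hY
    have h' : MDifferentiableAt 𝓘(ℝ, E) (𝓘(ℝ, E).prod 𝓘(ℝ, ℝ))
        (fun q => TotalSpace.mk' ℝ (E := Bundle.Trivial M ℝ) q (θ q (Y q))) p :=
      MDifferentiableAt.clm_bundle_apply (F₁ := E) hθ hY
    simp only [mdifferentiableAt_totalSpace] at h'
    exact h'.2
  constructor
  · intro f Y hf hY
    ext x
    simp [mvfderiv_fun_mul hf (h hY), nabla.isCovariantDerivativeOn.leibniz hY hf]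
    ring
  · intro Y Y' hY hY'
    ext x
    simp [mvfderiv_fun_add (h hY) (h hY'), nabla.isCovariantDerivativeOn.add hY hY']
    ring

open Classical in
/-- The covariant derivative `L(θ) = ∇θ` of a 1-form, `L(θ)(x, y) = (∇_x θ)(y)`, where
`(∇_X θ)(Y) = X θ(Y) - θ(∇_X Y)`. It is set to zero at points where `θ` is not differentiable. -/
def nablaForm (nabla : Connection E M) (θ : FormField E M) (p : M) :
    LinearMap.BilinForm ℝ (TangentSpace 𝓘(ℝ, E) p) :=
  if hθ : θ.DiffAt p then
    LinearMap.mk₂ ℝ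
      (fun x y => TensorialAt.mkHom _ p (tensorialAt_nablaForm nabla θ p hθ) y x)
      (by simp) (by simp) (by simp) (by simp)
  else 0

/-- The defining formula of `∇θ`. -/
theorem nablaForm_apply (nabla : Connection E M) (θ : FormField E M) (p : M) (hθ : θ.DiffAt p)
    (Y : Π q : M, TangentSpace 𝓘(ℝ, E) q) (hY : MDiffAt (T% Y) p)
    (x : TangentSpace 𝓘(ℝ, E) p) :
    nablaForm nabla θ p x (Y p)
      = mvfderiv 𝓘(ℝ, E) (fun q => θ q (Y q)) p x - θ p (nabla Y p x) := by
  rw [nablaForm, dif_pos hθ, LinearMap.mk₂_apply,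
    TensorialAt.mkHom_apply (tensorialAt_nablaForm nabla θ p hθ) hY]
  rfl

variable (E M) in
/-- An almost contact metric structure `(φ, ξ, η, g)` on the manifold `M`. -/
structure AlmostContactMetricStructure where
  φ : Π p : M, TangentSpace 𝓘(ℝ, E) p →L[ℝ] TangentSpace 𝓘(ℝ, E) p
  ξ : Π p : M, TangentSpace 𝓘(ℝ, E) p
  η : FormField E M
  g : SmoothMetric E M
  φ_smooth : ContMDiff 𝓘(ℝ, E) (𝓘(ℝ, E).prod 𝓘(ℝ, E →L[ℝ] E)) ∞
    (fun p => TotalSpace.mk' (E →L[ℝ] E)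
      (E := fun p : M => TangentSpace 𝓘(ℝ, E) p →L[ℝ] TangentSpace 𝓘(ℝ, E) p) p (φ p))
  ξ_smooth : ContMDiff 𝓘(ℝ, E) 𝓘(ℝ, E).tangent ∞ (T% ξ)
  η_smooth : η.IsOneForm
  φ_φ : ∀ p x, φ p (φ p x) = -x + η p x • ξ p
  φ_ξ : ∀ p, φ p (ξ p) = 0
  η_φ : ∀ p x, η p (φ p x) = 0
  g_ξ_ξ : ∀ p, g.inner p (ξ p) (ξ p) = 1
  g_φ_φ : ∀ p x y, g.inner p (φ p x) (φ p y) = g.inner p x y - η p x * η p y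

namespace AlmostContactMetricStructure

variable (S : AlmostContactMetricStructure E M)

/-- The almost contact metric structure on the tangent space at `p`. -/
def fiber (p : M) : AlmostContactMetric (TangentSpace 𝓘(ℝ, E) p) where
  φ := (S.φ p).toLinearMap
  ξ := S.ξ p
  η := (S.η p).toLinearMap
  g := LinearMap.mk₂ ℝ (fun x y => S.g.inner p x y) (by simp) (by simp) (by simp) (by simp)
  g_symm := S.g.symm p
  g_pos := S.g.pos p
  φ_φ := S.φ_φ p
  φ_ξ := S.φ_ξ p
  η_φ := S.η_φ p
  g_ξ_ξ := S.g_ξ_ξ p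
  g_φ_φ := S.g_φ_φ p

/-- The fundamental 2-form `Φ(x, y) = g(x, φ y)`. -/
def fundForm (p : M) (x y : TangentSpace 𝓘(ℝ, E) p) : ℝ := S.g.inner p x (S.φ p y)

/-- `X ↦ (∇_X Φ)(Y, Z) = X Φ(Y, Z) - Φ(∇_X Y, Z) - Φ(Y, ∇_X Z)` at the point `p`, for vector
fields `Y`, `Z`. -/
def nablaFundFormAux (nabla : Connection E M) (Y Z : Π q : M, TangentSpace 𝓘(ℝ, E) q) (p : M) :
    TangentSpace 𝓘(ℝ, E) p →L[ℝ] ℝ :=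
  mvfderiv 𝓘(ℝ, E) (fun q => S.fundForm q (Y q) (Z q)) p
    - S.g.inner p (S.φ p (Z p)) ∘L nabla Y p
    - S.g.inner p (Y p) ∘L S.φ p ∘L nabla Z p

theorem nablaFundFormAux_apply (nabla : Connection E M)
    (Y Z : Π q : M, TangentSpace 𝓘(ℝ, E) q) (p : M) (x : TangentSpace 𝓘(ℝ, E) p) :
    S.nablaFundFormAux nabla Y Z p x
      = mvfderiv 𝓘(ℝ, E) (fun q => S.fundForm q (Y q) (Z q)) p x
        - S.fundForm p (nabla Y p x) (Z p) - S.fundForm p (Y p) (nabla Z p x) := by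
  rw [fundForm, S.g.symm p (nabla Y p x)]
  rfl

theorem fundForm_diffAt {p : M} {Y Z : Π q : M, TangentSpace 𝓘(ℝ, E) q}
    (hY : MDiffAt (T% Y) p) (hZ : MDiffAt (T% Z) p) :
    MDiffAt (fun q => S.fundForm q (Y q) (Z q)) p := by
  have hφ : MDifferentiableAt 𝓘(ℝ, E) (𝓘(ℝ, E).prod 𝓘(ℝ, E))
      (fun q => TotalSpace.mk' E (E := fun q : M => TangentSpace 𝓘(ℝ, E) q) q
        (S.φ q (Z q))) p :=
    MDifferentiableAt.clm_bundle_apply (F₁ := E)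
      ((S.φ_smooth p).mdifferentiableAt (by simp)) hZ
  have h' : MDifferentiableAt 𝓘(ℝ, E) (𝓘(ℝ, E).prod 𝓘(ℝ, ℝ))
      (fun q => TotalSpace.mk' ℝ (E := Bundle.Trivial M ℝ) q
        (S.g.inner q (Y q) (S.φ q (Z q)))) p :=
    MDifferentiableAt.clm_bundle_apply₂ (F₁ := E) (F₂ := E)
      ((S.g.contMDiff p).mdifferentiableAt (by simp)) hY hφ
  simp only [mdifferentiableAt_totalSpace] at h'
  exact h'.2

theorem tensorialAt_nablaFundForm₁ (nabla : Connection E M) (p : M)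
    (Z : Π q : M, TangentSpace 𝓘(ℝ, E) q) (hZ : MDiffAt (T% Z) p) :
    TensorialAt 𝓘(ℝ, E) E (fun Y => S.nablaFundFormAux nabla Y Z p) p := by
  constructor
  · intro f Y hf hY
    have h0 := S.fundForm_diffAt hY hZ
    simp only [fundForm] at h0
    ext x
    simp [nablaFundFormAux_apply, fundForm,
      mvfderiv_fun_mul hf h0, nabla.isCovariantDerivativeOn.leibniz hY hf]
    ring
  · intro Y Y' hY hY'
    have h0 := S.fundForm_diffAt hY hZ
    have h1 := S.fundForm_diffAt hY' hZ
    simp only [fundForm] at h0 h1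
    ext x
    simp [nablaFundFormAux_apply, fundForm,
      mvfderiv_fun_add h0 h1,
      nabla.isCovariantDerivativeOn.add hY hY']
    ring

theorem tensorialAt_nablaFundForm₂ (nabla : Connection E M) (p : M)
    (Y : Π q : M, TangentSpace 𝓘(ℝ, E) q) (hY : MDiffAt (T% Y) p) :
    TensorialAt 𝓘(ℝ, E) E (fun Z => S.nablaFundFormAux nabla Y Z p) p := by
  constructor
  · intro f Z hf hZ
    have h0 := S.fundForm_diffAt hY hZ
    simp only [fundForm] at h0
    ext x
    simp [nablaFundFormAux_apply, fundForm,
      mvfderiv_fun_mul hf h0, nabla.isCovariantDerivativeOn.leibniz hZ hf]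
    ring
  · intro Z Z' hZ hZ'
    have h0 := S.fundForm_diffAt hY hZ
    have h1 := S.fundForm_diffAt hY hZ'
    simp only [fundForm] at h0 h1
    ext x
    simp [nablaFundFormAux_apply, fundForm,
      mvfderiv_fun_add h0 h1,
      nabla.isCovariantDerivativeOn.add hZ hZ']
    ring

/-- The covariant derivative of `Φ` at `p`; its value at `y`, `z`, `x` is `(∇_x Φ)(y, z)`. -/
def nablaFundForm (nabla : Connection E M) (p : M) :
    TangentSpace 𝓘(ℝ, E) p →L[ℝ] TangentSpace 𝓘(ℝ, E) p →L[ℝ] TangentSpace 𝓘(ℝ, E) p →L[ℝ] ℝ :=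
  TensorialAt.mkHom₂ (fun Y Z => S.nablaFundFormAux nabla Y Z p) p
    (S.tensorialAt_nablaFundForm₁ nabla p) (S.tensorialAt_nablaFundForm₂ nabla p)

/-- The tensor `F = -∇Φ`, i.e. `F(x, y, z) = -(∇_x Φ)(y, z)`. -/
def F (nabla : Connection E M) (p : M) (x y z : TangentSpace 𝓘(ℝ, E) p) : ℝ :=
  -S.nablaFundForm nabla p y z x

/-- The defining formula of `F = -∇Φ`. -/
theorem F_apply (nabla : Connection E M) (p : M) (Y Z : Π q : M, TangentSpace 𝓘(ℝ, E) q)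
    (hY : MDiffAt (T% Y) p) (hZ : MDiffAt (T% Z) p) (x : TangentSpace 𝓘(ℝ, E) p) :
    S.F nabla p x (Y p) (Z p)
      = -(mvfderiv 𝓘(ℝ, E) (fun q => S.fundForm q (Y q) (Z q)) p x
        - S.fundForm p (nabla Y p x) (Z p) - S.fundForm p (Y p) (nabla Z p x)) := by
  rw [F, nablaFundForm, TensorialAt.mkHom₂_apply (S.tensorialAt_nablaFundForm₁ nabla p)
    (S.tensorialAt_nablaFundForm₂ nabla p) hY hZ, nablaFundFormAux_apply]

section Linearity

variable (nabla : Connection E M) (p : M) (c : ℝ) (x x' y y' z z' : TangentSpace 𝓘(ℝ, E) p)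

theorem F_add₁ : S.F nabla p (x + x') y z = S.F nabla p x y z + S.F nabla p x' y z := by
  rw [F, map_add, neg_add]; rfl

theorem F_smul₁ : S.F nabla p (c • x) y z = c • S.F nabla p x y z := by
  rw [F, map_smul, ← smul_neg]; rfl

set_option synthInstance.maxHeartbeats 200000 in
theorem F_add₂ : S.F nabla p x (y + y') z = S.F nabla p x y z + S.F nabla p x y' z := by
  rw [F, map_add, add_apply, add_apply, neg_add]; rfl

set_option synthInstance.maxHeartbeats 200000 in
theorem F_smul₂ : S.F nabla p x (c • y) z = c • S.F nabla p x y z := by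
  rw [F, map_smul, smul_apply, smul_apply, ← smul_neg]; rfl

theorem F_add₃ : S.F nabla p x y (z + z') = S.F nabla p x y z + S.F nabla p x y z' := by
  rw [F, map_add, add_apply, neg_add]; rfl

theorem F_smul₃ : S.F nabla p x y (c • z) = c • S.F nabla p x y z := by
  rw [F, map_smul, smul_apply, ← smul_neg]; rfl

/-- The bilinear form `(x, y) ↦ F(x, y, z)`. -/
def FBilin : LinearMap.BilinForm ℝ (TangentSpace 𝓘(ℝ, E) p) :=
  LinearMap.mk₂ ℝ (fun x y => S.F nabla p x y z)
    (fun x x' y => S.F_add₁ nabla p x x' y z) (fun c x y => S.F_smul₁ nabla p c x y z)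
    (fun x y y' => S.F_add₂ nabla p x y y' z) (fun c x y => S.F_smul₂ nabla p c x y z)

theorem FBilin_add :
    S.FBilin nabla p (z + z') = S.FBilin nabla p z + S.FBilin nabla p z' :=
  LinearMap.ext₂ fun x y => S.F_add₃ nabla p x y z z'

theorem FBilin_smul : S.FBilin nabla p (c • z) = c • S.FBilin nabla p z :=
  LinearMap.ext₂ fun x y => S.F_smul₃ nabla p c x y z

end Linearity

/-- `f(z) = ∑ F(eᵢ, eᵢ, z)` over an orthonormal basis. -/
def fForm (nabla : Connection E M) : FormField E M := fun p =>
  LinearMap.toContinuousLinearMap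
    { toFun := fun z => (S.fiber p).metricTrace (S.FBilin nabla p z)
      map_add' := by
        intro z z'
        simp [AlmostContactMetric.metricTrace, FBilin_add, LinearMap.comp_add]
      map_smul' := by
        intro c z
        simp [AlmostContactMetric.metricTrace, FBilin_smul, LinearMap.comp_smul] }

/-- `f*(z) = ∑ F(eᵢ, φ eᵢ, z)` over an orthonormal basis. -/
def fStarForm (nabla : Connection E M) : FormField E M := fun p =>
  LinearMap.toContinuousLinearMap
    { toFun := fun z =>
        (S.fiber p).metricTrace ((S.FBilin nabla p z).compl₂ (S.fiber p).φ)
      map_add' := by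
        intro z z'
        have h : (S.FBilin nabla p z + S.FBilin nabla p z').compl₂ (S.fiber p).φ
          = (S.FBilin nabla p z).compl₂ (S.fiber p).φ
            + (S.FBilin nabla p z').compl₂ (S.fiber p).φ := rfl
        simp [AlmostContactMetric.metricTrace, FBilin_add, h, LinearMap.comp_add]
      map_smul' := by
        intro c z
        have h : (c • S.FBilin nabla p z).compl₂ (S.fiber p).φ
          = c • (S.FBilin nabla p z).compl₂ (S.fiber p).φ := rfl
        simp [AlmostContactMetric.metricTrace, FBilin_smul, h, LinearMap.comp_smul] }

/-- `ω(z) = F(ξ, ξ, z)`. -/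
def ωForm (nabla : Connection E M) : FormField E M := fun p =>
  LinearMap.toContinuousLinearMap
    { toFun := fun z => S.F nabla p (S.ξ p) (S.ξ p) z
      map_add' := fun z z' => S.F_add₃ nabla p _ _ z z'
      map_smul' := fun c z => S.F_smul₃ nabla p c _ _ z }

/-- The Lee form `f*(ξ) / (2n) η + 1 / (2(n-1)) f ∘ φ` in dimension `2 n + 1`, `n ≥ 2`. -/
def leeForm (nabla : Connection E M) (n : ℕ) : FormField E M := fun p =>
  (S.fStarForm nabla p (S.ξ p) / (2 * (n : ℝ))) • S.η p
    + (1 / (2 * ((n : ℝ) - 1))) • (S.fForm nabla p ∘L S.φ p)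

/-- `θ` is the Lee form of the structure. Besides the general formula, which requires `n ≥ 2`, the
normalization `θ = ω ∘ φ` that is used for the class `W₁` is admitted; on this class the two
differ by the constant factor `2 (n - 1)`. -/
def IsLeeForm (nabla : Connection E M) (n : ℕ) (θ : FormField E M) : Prop :=
  (2 ≤ n ∧ θ = S.leeForm nabla n) ∨ θ = fun p => S.ωForm nabla p ∘L S.φ p

/-- The class `W₁`: `F = η ⊗ (η ∧ ω)`. -/
def InW₁ (nabla : Connection E M) : Prop :=
  ∀ (p : M) (x y z : TangentSpace 𝓘(ℝ, E) p),
    S.F nabla p x y z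
      = S.η p x * (S.η p y * S.ωForm nabla p z - S.η p z * S.ωForm nabla p y)

/-- The 1-form `θ` belongs to the direct sum of the subspaces `Ωⱼ`, `j ∈ J`: its covariant
derivative lies at each point in the direct sum of the tensor subspaces with indices in `J`. -/
def InΩ (nabla : Connection E M) (n : ℕ) (J : Set ℕ) (θ : FormField E M) : Prop :=
  θ.IsOneForm ∧
    ∀ p, nablaForm nabla θ p ∈ ⨆ j ∈ J, (S.fiber p).tensorSubspace n j

/-- The direct sum of the subclasses `W₁ⱼ`, `j ∈ J`, of the class `W₁`, where `θ` is the Lee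
form. -/
def InW₁Sum (nabla : Connection E M) (n : ℕ) (J : Set ℕ) (θ : FormField E M) : Prop :=
  S.InW₁ nabla ∧ S.InΩ nabla n J θ

/-- The subclass `W₁⁰` of `W₁`, where `θ` is the Lee form: `θ` is closed. -/
def InW₁Closed (nabla : Connection E M) (θ : FormField E M) : Prop :=
  S.InW₁ nabla ∧ θ.IsOneForm ∧ θ.IsClosedForm

end AlmostContactMetricStructure

end Manifold

end

/-! The theorem has a pointwise algebraic half and a differential half, which meet in one question:
which part of `∇θ` is symmetric.

Algebra. Every bilinear form splits as `L = hL + vL + wL`. Symmetry, behaviour under `h`, behaviour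
under `φ` and the traces `α`, `β` separate the nine types, so each operator `Lᵢ` kills the subspaces
of the other types (`component_eq_zero_of_mem_tensorSubspace`). Since `Lᵢ` is the identity on its
own subspace, independence follows. If `hL` is symmetric, then `L` is the sum of its components 1,
2, 3, 7, 8, 9 (`sum_components`); if `L` itself is symmetric, component 8 vanishes too, and
conversely types 1, 2, 3, 7, 9 consist of symmetric forms.

Geometry. For a torsion-free connection the skew part of `∇θ` is `dθ` up to a factor, so closed
means `∇θ` symmetric (`isClosedForm_iff`); this settles `W₁⁰`. For `W₁` it remains to see that `dθ`
vanishes on `ker η`. The identity `(∇_x η)(y) = F(x, φ y, ξ)` turns the condition on `F` into `∇η =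
-η ⊗ (ω ∘ φ)`. The Lee form is a nonzero constant multiple of `ω ∘ φ`, hence `dη = κ θ ∧ η` with `κ
≠ 0`. Applying `d` once more gives `dθ ∧ η = 0`, and inserting `ξ` together with two vectors of `ker
η` gives the claim (`nablaForm_comm_of_mem_ker`). -/

set_option linter.unusedSectionVars false

/-! ### Pointwise identities for `φ`, `ξ`, `η`, `g` and the traces `α`, `β`. -/

namespace AlmostContactMetric

section Algebra

variable {V : Type*} [AddCommGroup V] [Module ℝ V] (S : AlmostContactMetric V)

/-- Not an axiom of the structure: `φ²ξ = 0` forces `(η(ξ) - 1) ξ = 0`, and `ξ ≠ 0` because it has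
length 1. -/
theorem η_ξ : S.η S.ξ = 1 := by
  have h := S.φ_φ S.ξ
  rw [S.φ_ξ, map_zero] at h
  have h0 : S.ξ ≠ 0 := by
    intro h0
    simpa [h0] using S.g_ξ_ξ
  have h1 : (S.η S.ξ - 1) • S.ξ = 0 := by
    rw [sub_smul, one_smul, sub_eq_neg_add]
    exact h.symm
  exact sub_eq_zero.1 ((smul_eq_zero.1 h1).resolve_right h0)

theorem g_ξ_right (x : V) : S.g x S.ξ = S.η x := by
  have h := S.g_φ_φ x S.ξ
  rw [S.φ_ξ, map_zero, S.η_ξ] at h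
  linarith

theorem g_ξ_left (x : V) : S.g S.ξ x = S.η x := by rw [S.g_symm, S.g_ξ_right]

theorem g_φ_left (x y : V) : S.g (S.φ x) y = -S.g x (S.φ y) := by
  have h := S.g_φ_φ x (S.φ y)
  rw [S.φ_φ, S.η_φ] at h
  simp only [map_add, map_neg, map_smul, S.g_ξ_right, S.η_φ, smul_zero, mul_zero] at h
  linarith

theorem hMap_apply (x : V) : S.hMap x = x - S.η x • S.ξ := by
  simp [hMap, S.φ_φ]
  abel

theorem φ_hMap (x : V) : S.φ (S.hMap x) = S.φ x := by
  simp [hMap_apply, S.φ_ξ]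

theorem hMap_φ (x : V) : S.hMap (S.φ x) = S.φ x := by
  simp [hMap_apply, S.η_φ]

theorem hMap_hMap (x : V) : S.hMap (S.hMap x) = S.hMap x := by
  simp [hMap_apply, S.η_ξ]

theorem hMap_ξ : S.hMap S.ξ = 0 := by
  simp [hMap_apply, S.η_ξ]

theorem η_hMap (x : V) : S.η (S.hMap x) = 0 := by
  simp [hMap_apply, S.η_ξ]

theorem hMetric_apply (x y : V) : S.hMetric x y = S.g (S.hMap x) y := by
  simp [hMetric, hPart_apply, hMap_apply, S.g_ξ_right, S.g_ξ_left, S.η_ξ, mul_comm]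

theorem hMetric_symm (x y : V) : S.hMetric x y = S.hMetric y x := by
  rw [hMetric, hPart_apply, hPart_apply, S.g_symm]

theorem hMetric_φ_φ (x y : V) : S.hMetric (S.φ x) (S.φ y) = S.hMetric x y := by
  rw [hMetric, hPart_apply, hPart_apply, hMap_φ, hMap_φ, ← S.φ_hMap x, ← S.φ_hMap y, S.g_φ_φ,
    η_hMap]
  simp

theorem hMetric_hMap (x y : V) : S.hMetric (S.hMap x) (S.hMap y) = S.hMetric x y := by
  rw [hMetric, hPart_apply, hPart_apply, hMap_hMap, hMap_hMap]

theorem hMetric_φ_left (x y : V) : S.hMetric (S.φ x) y = -S.hMetric x (S.φ y) := by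
  rw [hMetric, hPart_apply, hPart_apply, hMap_φ, hMap_φ, ← φ_hMap, g_φ_left, φ_hMap]

theorem hMetricφ_apply (x y : V) : S.hMetricφ x y = S.hMetric x (S.φ y) := rfl

/-! ### The metric trace -/

variable [FiniteDimensional ℝ V]

theorem metricTrace_eq_trace {B : LinearMap.BilinForm ℝ V} {T : V →ₗ[ℝ] V}
    (h : ∀ x y, S.g (T x) y = B x y) : S.metricTrace B = LinearMap.trace ℝ V T := by
  rw [metricTrace]
  congr 1
  refine LinearMap.ext fun x => ?_
  rw [LinearMap.comp_apply, LinearEquiv.coe_coe, LinearEquiv.symm_apply_eq]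
  refine LinearMap.ext fun y => ?_
  rw [LinearMap.BilinForm.toDual_def, h]

theorem exists_metric_representation (B : LinearMap.BilinForm ℝ V) :
    ∃ T : V →ₗ[ℝ] V, ∀ x y, S.g (T x) y = B x y := by
  refine ⟨(LinearMap.BilinForm.toDual S.g S.g_nondegenerate).symm.toLinearMap ∘ₗ B,
    fun x y => ?_⟩
  simp

/-- If `T` represents `B`, its `g`-adjoint represents the flip. The adjoint is the transpose of `T`
conjugated by the isomorphism of `V` with its dual, so it has the same trace. -/
theorem metricTrace_flip (B : LinearMap.BilinForm ℝ V) :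
    S.metricTrace (LinearMap.flip B) = S.metricTrace B := by
  obtain ⟨T, hT⟩ := S.exists_metric_representation B
  rw [S.metricTrace_eq_trace hT]
  set D := LinearMap.BilinForm.toDual S.g S.g_nondegenerate
  have h : ∀ x y, S.g ((D.symm.conj T.dualMap) x) y = LinearMap.flip B x y := by
    intro x y
    rw [LinearEquiv.conj_apply]
    simp only [LinearMap.comp_apply, LinearEquiv.coe_coe, LinearEquiv.symm_symm]
    rw [LinearMap.BilinForm.apply_toDual_symm_apply]
    simp [D, LinearMap.BilinForm.toDual_def, ← hT, S.g_symm x]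
  rw [S.metricTrace_eq_trace h, LinearMap.trace_conj']
  exact LinearMap.trace_transpose' T

theorem metricTrace_neg (B : LinearMap.BilinForm ℝ V) :
    S.metricTrace (-B) = -S.metricTrace B := by
  simp [metricTrace, LinearMap.comp_neg]

/-- The two forms are represented by `T φ` and `-φ T`, the sign coming from skewness of `φ` with
respect to `g`; the traces of `T φ` and `φ T` agree. -/
theorem metricTrace_compl₁ (B : LinearMap.BilinForm ℝ V) :
    S.metricTrace (B ∘ₗ S.φ) = -S.metricTrace (B.compl₂ S.φ) := by
  obtain ⟨T, hT⟩ := S.exists_metric_representation B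
  have h1 : ∀ x y, S.g ((T ∘ₗ S.φ) x) y = (B ∘ₗ S.φ) x y := fun x y => hT _ _
  have h2 : ∀ x y, S.g ((-(S.φ ∘ₗ T)) x) y = B.compl₂ S.φ x y := by
    intro x y
    simp [g_φ_left, hT]
  rw [S.metricTrace_eq_trace h1, S.metricTrace_eq_trace h2, map_neg, neg_neg,
    LinearMap.trace_comp_comm']

theorem metricTrace_smulRight (μ ν : V →ₗ[ℝ] ℝ) {v : V} (hv : ∀ x, S.g v x = ν x) :
    S.metricTrace (μ.smulRight ν) = μ v := by
  rw [S.metricTrace_eq_trace (T := μ.smulRight v) (by intro x y; simp [hv]),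
    LinearMap.trace_smulRight]

theorem traceα_eq_zero_of_flip_eq_neg {L : LinearMap.BilinForm ℝ V}
    (h : LinearMap.flip L = -L) : S.traceα L = 0 := by
  have h1 : LinearMap.flip (S.hPart L) = -S.hPart L := by
    refine LinearMap.ext₂ fun x y => ?_
    exact LinearMap.congr_fun₂ h (S.hMap x) (S.hMap y)
  have h2 := S.metricTrace_flip (S.hPart L)
  rw [h1, metricTrace_neg] at h2
  rw [traceα]
  linarith

/-- Moving `φ` from the first slot to the second costs a sign under the trace, and `φ² = -1` on the
image of `h` gives it back. The same argument applies to `β`. -/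
theorem traceα_compφ (L : LinearMap.BilinForm ℝ V) : S.traceα (S.compφ L) = S.traceα L := by
  have h1 : S.hPart (S.compφ L) = (S.hPart L).compl₂ S.φ ∘ₗ S.φ := by
    refine LinearMap.ext₂ fun x y => ?_
    simp [hPart_apply, compφ_apply, φ_hMap, hMap_φ]
  have h2 : ((S.hPart L).compl₂ S.φ).compl₂ S.φ = -S.hPart L := by
    refine LinearMap.ext₂ fun x y => ?_
    simp [hPart_apply, S.φ_φ, hMap_ξ]
  rw [traceα, traceα, h1, metricTrace_compl₁, h2, metricTrace_neg, neg_neg]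

theorem traceβ_compφ (L : LinearMap.BilinForm ℝ V) : S.traceβ (S.compφ L) = S.traceβ L := by
  have h1 : (S.hPart (S.compφ L)).compl₂ S.φ = ((S.hPart L).compl₂ S.φ).compl₂ S.φ ∘ₗ S.φ := by
    refine LinearMap.ext₂ fun x y => ?_
    simp [hPart_apply, compφ_apply, φ_hMap, hMap_φ]
  have h2 : (((S.hPart L).compl₂ S.φ).compl₂ S.φ).compl₂ S.φ = -(S.hPart L).compl₂ S.φ := by
    refine LinearMap.ext₂ fun x y => ?_
    simp [hPart_apply, S.φ_φ, S.φ_ξ]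
  rw [traceβ, traceβ, h1, metricTrace_compl₁, h2, metricTrace_neg, neg_neg]

/-- For symmetric `L` the flip of `hL(x, φ y)` is `hL(φ x, y)`: the flip preserves the trace, while
moving `φ` across reverses its sign. -/
theorem traceβ_eq_zero_of_flip_eq {L : LinearMap.BilinForm ℝ V}
    (h : LinearMap.flip L = L) : S.traceβ L = 0 := by
  have h1 : LinearMap.flip ((S.hPart L).compl₂ S.φ) = S.hPart L ∘ₗ S.φ := by
    refine LinearMap.ext₂ fun x y => ?_
    exact LinearMap.congr_fun₂ h (S.hMap (S.φ x)) (S.hMap y)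
  have h2 := S.metricTrace_flip ((S.hPart L).compl₂ S.φ)
  rw [h1, metricTrace_compl₁] at h2
  rw [traceβ]
  linarith

theorem traceα_hMetric {n : ℕ} (hn : Module.finrank ℝ V = 2 * n + 1) :
    S.traceα S.hMetric = 2 * n := by
  have h : ∀ x y, S.g ((LinearMap.id - S.η.smulRight S.ξ : V →ₗ[ℝ] V) x) y = S.hPart S.hMetric x y := by
    intro x y
    rw [hPart_apply, hMetric_hMap, hMetric_apply, hMap_apply]
    rfl
  rw [traceα, S.metricTrace_eq_trace h, map_sub, LinearMap.trace_id, LinearMap.trace_smulRight,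
    S.η_ξ, hn]
  push_cast
  ring

theorem traceβ_hMetricφ {n : ℕ} (hn : Module.finrank ℝ V = 2 * n + 1) :
    S.traceβ S.hMetricφ = -(2 * n) := by
  rw [← S.traceα_hMetric hn, traceα, traceβ, ← metricTrace_neg]
  congr 1
  refine LinearMap.ext₂ fun x y => ?_
  simp [hPart_apply, hMetricφ_apply, S.φ_φ, hMap_apply, hMetric_apply, S.g_ξ_right,
    S.g_ξ_left, S.η_ξ, S.η_φ]
  ring

end Algebra

end AlmostContactMetric

/-! ### The nine types: independence, and decomposition of forms with symmetric horizontal part. -/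

namespace AlmostContactMetric

section Decomposition

variable {V : Type*} [AddCommGroup V] [Module ℝ V] [FiniteDimensional ℝ V]
  (S : AlmostContactMetric V) {n : ℕ} {L : LinearMap.BilinForm ℝ V}

theorem mem_tensorSubspace {i : ℕ} : L ∈ S.tensorSubspace n i ↔ L = S.component n i L := Iff.rfl

theorem traceα_hPart (L : LinearMap.BilinForm ℝ V) : S.traceα (S.hPart L) = S.traceα L := by
  rw [traceα, traceα]
  congr 1
  refine LinearMap.ext₂ fun x y => ?_
  simp only [hPart_apply, hMap_hMap]

theorem traceα_flip (L : LinearMap.BilinForm ℝ V) : S.traceα (LinearMap.flip L) = S.traceα L :=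
  S.metricTrace_flip (S.hPart L)

theorem traceα_symPart (L : LinearMap.BilinForm ℝ V) : S.traceα (symPart L) = S.traceα L := by
  rw [symPart, traceα_smul, traceα_add, traceα_flip]
  ring

theorem traceα_neg (L : LinearMap.BilinForm ℝ V) : S.traceα (-L) = -S.traceα L := by
  rw [← neg_one_smul ℝ L, traceα_smul, neg_one_mul]

theorem traceα_sub (L K : LinearMap.BilinForm ℝ V) :
    S.traceα (L - K) = S.traceα L - S.traceα K := by
  have h : L - K = L + (-1 : ℝ) • K := LinearMap.ext₂ fun x y => by simp; ring
  rw [h, traceα_add, traceα_smul]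
  ring

theorem traceβ_neg (L : LinearMap.BilinForm ℝ V) : S.traceβ (-L) = -S.traceβ L := by
  rw [← neg_one_smul ℝ L, traceβ_smul, neg_one_mul]

theorem traceβ_sub (L K : LinearMap.BilinForm ℝ V) :
    S.traceβ (L - K) = S.traceβ L - S.traceβ K := by
  have h : L - K = L + (-1 : ℝ) • K := LinearMap.ext₂ fun x y => by simp; ring
  rw [h, traceβ_add, traceβ_smul]
  ring

/-! ### Symmetries of the component subspaces -/

/-- This and the next lemmas tabulate the signs of the nine types under flip, `h` and `∘ φ`. The
signs separate all types except the pairs 1 and 2, 4 and 5, 7 and 9, which need the traces or the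
value at `(ξ, ξ)`. -/
theorem flip_eq_of_mem_tensorSubspace {i : ℕ} (hi : i ∈ ({1, 2, 3, 7, 9} : Set ℕ))
    (hL : L ∈ S.tensorSubspace n i) : LinearMap.flip L = L := by
  rw [mem_tensorSubspace] at hL
  refine LinearMap.ext₂ fun x y => ?_
  rw [LinearMap.flip_apply, hL]
  rcases hi with rfl | rfl | rfl | rfl | rfl
  · simp [component, S.hMetric_symm x]
  · simp [component, S.hMetric_symm x, symPart_apply, compφ_apply]
    ring
  · simp [component, symPart_apply, compφ_apply]
    ring
  · simp [component, symPart_apply]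
    ring
  · simp only [component, wPart_apply, mul_comm]

theorem flip_eq_neg_of_mem_tensorSubspace {i : ℕ} (hi : i ∈ ({4, 5, 6, 8} : Set ℕ))
    (hL : L ∈ S.tensorSubspace n i) : LinearMap.flip L = -L := by
  have h4 : ∀ x y, S.hMetricφ y x = -S.hMetricφ x y := fun x y => by
    rw [hMetricφ_apply, hMetric_symm, hMetric_φ_left, hMetricφ_apply]
  rw [mem_tensorSubspace] at hL
  refine LinearMap.ext₂ fun x y => ?_
  rw [LinearMap.flip_apply, LinearMap.neg_apply, LinearMap.neg_apply, hL]
  rcases hi with rfl | rfl | rfl | rfl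
  · simp [component, h4 x]
  · simp [component, h4 x, altPart_apply, compφ_apply]
    ring
  · simp [component, altPart_apply, compφ_apply]
    ring
  · simp [component, altPart_apply]
    ring

theorem hPart_eq_of_mem_tensorSubspace {i : ℕ} (hi : i ∈ ({1, 2, 3, 4, 5, 6} : Set ℕ))
    (hL : L ∈ S.tensorSubspace n i) : S.hPart L = L := by
  have hφ : ∀ x y, S.hMetric (S.hMap x) (S.φ y) = S.hMetric x (S.φ y) := fun x y => by
    rw [← hMetric_hMap, hMap_hMap, hMetric_hMap]
  rw [mem_tensorSubspace] at hL
  refine LinearMap.ext₂ fun x y => ?_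
  rw [hPart_apply, hL]
  rcases hi with rfl | rfl | rfl | rfl | rfl | rfl <;>
  simp [component, hMetric_hMap, symPart_apply, altPart_apply, compφ_apply, hPart_apply,
    hMetricφ_apply, φ_hMap, hMap_hMap, hφ]

theorem hPart_eq_zero_of_mem_tensorSubspace {i : ℕ} (hi : i ∈ ({7, 8, 9} : Set ℕ))
    (hL : L ∈ S.tensorSubspace n i) : S.hPart L = 0 := by
  rw [mem_tensorSubspace] at hL
  refine LinearMap.ext₂ fun x y => ?_
  rw [hPart_apply, hL]
  rcases hi with rfl | rfl | rfl <;>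
  simp [component, symPart_apply, altPart_apply, vPart_apply, wPart_apply, η_hMap]

theorem compφ_eq_of_mem_tensorSubspace {i : ℕ} (hi : i ∈ ({1, 2, 4, 5} : Set ℕ))
    (hL : L ∈ S.tensorSubspace n i) : S.compφ L = L := by
  have hφ : ∀ x y, S.hMetricφ (S.φ x) (S.φ y) = S.hMetricφ x y := fun x y =>
    S.hMetric_φ_φ x (S.φ y)
  rw [mem_tensorSubspace] at hL
  refine LinearMap.ext₂ fun x y => ?_
  rw [compφ_apply, hL]
  rcases hi with rfl | rfl | rfl | rfl
  · simp [component, hMetric_φ_φ]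
  · simp [component, hMetric_φ_φ, symPart_apply, compφ_apply, hPart_apply, S.φ_φ, hMap_ξ]
    ring
  · simp only [component, LinearMap.smul_apply, hφ]
  · simp [component, hφ, altPart_apply, compφ_apply, hPart_apply, S.φ_φ, hMap_ξ]
    ring

theorem compφ_eq_neg_of_mem_tensorSubspace {i : ℕ} (hi : i ∈ ({3, 6} : Set ℕ))
    (hL : L ∈ S.tensorSubspace n i) : S.compφ L = -L := by
  rw [mem_tensorSubspace] at hL
  refine LinearMap.ext₂ fun x y => ?_
  rw [compφ_apply, LinearMap.neg_apply, LinearMap.neg_apply, hL]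
  rcases hi with rfl | rfl
  · simp [component, symPart_apply, compφ_apply, hPart_apply, S.φ_φ, hMap_ξ]
    ring
  · simp [component, altPart_apply, compφ_apply, hPart_apply, S.φ_φ, hMap_ξ]
    ring

/-! ### Vanishing of components -/

theorem altPart_eq_zero (h : LinearMap.flip L = L) : altPart L = 0 := by
  refine LinearMap.ext₂ fun x y => ?_
  rw [altPart_apply, ← LinearMap.congr_fun₂ h x y, LinearMap.flip_apply]
  simp

theorem symPart_eq_zero (h : LinearMap.flip L = -L) : symPart L = 0 := by
  refine LinearMap.ext₂ fun x y => ?_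
  have h1 : L y x = -L x y := LinearMap.congr_fun₂ h x y
  rw [symPart_apply, h1]
  simp

theorem flip_hPart (h : LinearMap.flip L = L) : LinearMap.flip (S.hPart L) = S.hPart L :=
  LinearMap.ext₂ fun x y => LinearMap.congr_fun₂ h (S.hMap x) (S.hMap y)

theorem flip_hPart_neg (h : LinearMap.flip L = -L) :
    LinearMap.flip (S.hPart L) = -S.hPart L :=
  LinearMap.ext₂ fun x y => LinearMap.congr_fun₂ h (S.hMap x) (S.hMap y)

theorem flip_vPart (h : LinearMap.flip L = L) : LinearMap.flip (S.vPart L) = S.vPart L := by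
  have h' : ∀ x y, L y x = L x y := fun x y => LinearMap.congr_fun₂ h x y
  refine LinearMap.ext₂ fun x y => ?_
  rw [LinearMap.flip_apply, vPart_apply, vPart_apply, h' y S.ξ, h' S.ξ x]
  ring

theorem flip_vPart_neg (h : LinearMap.flip L = -L) :
    LinearMap.flip (S.vPart L) = -S.vPart L := by
  have h' : ∀ x y, L y x = -L x y := fun x y => LinearMap.congr_fun₂ h x y
  have h0 : L S.ξ S.ξ = 0 := by linarith [h' S.ξ S.ξ]
  refine LinearMap.ext₂ fun x y => ?_
  rw [LinearMap.flip_apply, LinearMap.neg_apply, LinearMap.neg_apply, vPart_apply, vPart_apply,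
    h' S.ξ y, h' S.ξ x, h0]
  ring

theorem component_alternating_eq_zero (h : LinearMap.flip (S.hPart L) = S.hPart L) {i : ℕ}
    (hi : i ∈ ({4, 5, 6} : Set ℕ)) : S.component n i L = 0 := by
  have hβ : S.traceβ L = 0 := by
    have h1 := S.traceβ_eq_zero_of_flip_eq h
    rw [← h1, traceβ, traceβ]
    congr 1
    refine LinearMap.ext₂ fun x y => ?_
    simp [hPart_apply, hMap_hMap]
  have h0 : S.compφ 0 = 0 := rfl
  rcases hi with rfl | rfl | rfl <;>
  exact LinearMap.ext₂ fun x y => by simp [component, altPart_eq_zero h, hβ, h0]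

theorem component_eight_eq_zero (h : LinearMap.flip L = L) : S.component n 8 L = 0 :=
  altPart_eq_zero (S.flip_vPart h)

theorem component_eq_zero_of_flip_eq_neg (h : LinearMap.flip L = -L) {i : ℕ}
    (hi : i ∈ ({1, 2, 3, 7, 9} : Set ℕ)) : S.component n i L = 0 := by
  have h1 := symPart_eq_zero (S.flip_hPart_neg h)
  have h2 := symPart_eq_zero (S.flip_vPart_neg h)
  have h3 : L S.ξ S.ξ = 0 := by
    have := LinearMap.congr_fun₂ h S.ξ S.ξ
    simp only [LinearMap.flip_apply, LinearMap.neg_apply] at this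
    linarith
  have h0 : S.compφ 0 = 0 := rfl
  rcases hi with rfl | rfl | rfl | rfl | rfl <;>
  exact LinearMap.ext₂ fun x y => by
    simp [component, h1, h2, h0, S.traceα_eq_zero_of_flip_eq_neg h, wPart, h3]

theorem component_eq_zero_of_hPart_eq_zero (h : S.hPart L = 0) {i : ℕ}
    (hi : i ∈ ({1, 2, 3, 4, 5, 6} : Set ℕ)) : S.component n i L = 0 := by
  have h0 : S.compφ 0 = 0 := rfl
  have h1 : symPart (0 : LinearMap.BilinForm ℝ V) = 0 := symPart_eq_zero (neg_zero (G := V →ₗ[ℝ] V →ₗ[ℝ] ℝ)).symm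
  have h2 : altPart (0 : LinearMap.BilinForm ℝ V) = 0 := altPart_eq_zero rfl
  have hα : S.traceα L = 0 := by simp [traceα, metricTrace, h]
  have h3 : (0 : LinearMap.BilinForm ℝ V).compl₂ S.φ = 0 := rfl
  have hβ : S.traceβ L = 0 := by simp [traceβ, metricTrace, h, h3]
  rcases hi with rfl | rfl | rfl | rfl | rfl | rfl <;>
  exact LinearMap.ext₂ fun x y => by simp [component, h, h0, h1, h2, hα, hβ]

theorem component_eq_zero_of_hPart_eq (h : S.hPart L = L) {i : ℕ}
    (hi : i ∈ ({7, 8, 9} : Set ℕ)) : S.component n i L = 0 := by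
  have h1 : ∀ x, L x S.ξ = 0 := fun x => by rw [← h, hPart_apply, hMap_ξ, map_zero]
  have h2 : ∀ x, L S.ξ x = 0 := fun x => by
    rw [← h, hPart_apply, hMap_ξ, map_zero, LinearMap.zero_apply]
  refine LinearMap.ext₂ fun x y => ?_
  rcases hi with rfl | rfl | rfl <;>
  simp [component, symPart_apply, altPart_apply, vPart_apply, wPart_apply, h1, h2]

theorem component_three_six_eq_zero (h : S.hPart L = L) (h' : S.compφ L = L) {i : ℕ}
    (hi : i ∈ ({3, 6} : Set ℕ)) : S.component n i L = 0 := by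
  have h1 : ∀ x y, L (S.φ x) (S.φ y) = L x y := fun x y => LinearMap.congr_fun₂ h' x y
  refine LinearMap.ext₂ fun x y => ?_
  rcases hi with rfl | rfl <;>
  simp [component, symPart_apply, altPart_apply, compφ_apply, h, h1]

/-- Both traces are invariant under `∘ φ`, so they vanish on a form that changes sign; the average
over `∘ φ` vanishes as well. -/
theorem component_eq_zero_of_compφ_eq_neg (h : S.hPart L = L) (h' : S.compφ L = -L) {i : ℕ}
    (hi : i ∈ ({1, 2, 4, 5} : Set ℕ)) : S.component n i L = 0 := by
  have h1 : ∀ x y, L (S.φ x) (S.φ y) = -L x y := fun x y => LinearMap.congr_fun₂ h' x y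
  have hα : S.traceα L = 0 := by
    have := S.traceα_compφ L
    rw [h', traceα_neg] at this
    linarith
  have hβ : S.traceβ L = 0 := by
    have := S.traceβ_compφ L
    rw [h', traceβ_neg] at this
    linarith
  refine LinearMap.ext₂ fun x y => ?_
  rcases hi with rfl | rfl | rfl | rfl <;>
  simp [component, symPart_apply, altPart_apply, compφ_apply, h, h1, hα, hβ] <;> ring

theorem traceα_eq_zero_of_mem_two (hn : Module.finrank ℝ V = 2 * n + 1)
    (hL : L ∈ S.tensorSubspace n 2) : S.traceα L / (2 * n) = 0 := by
  -- For `n = 0` the quotient is zero by the convention for division by zero.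
  rcases eq_or_ne n 0 with rfl | h0
  · simp
  have h0' : (n : ℝ) ≠ 0 := Nat.cast_ne_zero.2 h0
  have h := congrArg S.traceα (S.mem_tensorSubspace.1 hL)
  simp only [component] at h
  rw [traceα_sub, traceα_smul, traceα_smul, traceα_add, traceα_compφ, traceα_symPart,
    traceα_hPart, S.traceα_hMetric hn, div_mul_cancel₀ _ (by positivity)] at h
  rw [h]
  ring

theorem traceβ_eq_zero_of_mem_five (hn : Module.finrank ℝ V = 2 * n + 1)
    (hL : L ∈ S.tensorSubspace n 5) : S.traceβ L / (2 * n) = 0 := by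
  rcases eq_or_ne n 0 with rfl | h0
  · simp
  have h0' : (n : ℝ) ≠ 0 := Nat.cast_ne_zero.2 h0
  have h1 : altPart (S.hPart L) = L := by
    rw [S.hPart_eq_of_mem_tensorSubspace (by simp) hL]
    refine LinearMap.ext₂ fun x y => ?_
    have h1 : L y x = -L x y :=
      LinearMap.congr_fun₂ (S.flip_eq_neg_of_mem_tensorSubspace (by simp) hL) x y
    rw [altPart_apply, h1]
    ring
  have h := congrArg S.traceβ (S.mem_tensorSubspace.1 hL)
  simp only [component, h1] at h
  rw [traceβ_sub, traceβ_smul, traceβ_smul, traceβ_add, traceβ_compφ,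
    S.traceβ_hMetricφ hn] at h
  have h2 : -(S.traceβ L / (2 * n)) * -(2 * (n : ℝ)) = S.traceβ L := by field_simp
  rw [h2] at h
  have h3 : S.traceβ L = 0 := by linarith
  rw [h3, zero_div]

/-- Type `j` is compared with `i` successively by `h`, by `∘ φ` and by symmetry, until only the
three exceptional pairs are left for direct computation. -/
theorem component_eq_zero_of_mem_tensorSubspace (hn : Module.finrank ℝ V = 2 * n + 1) {i j : ℕ}
    (hij : i ≠ j) (hL : L ∈ S.tensorSubspace n j) : S.component n i L = 0 := by
  have hflip : ∀ K : LinearMap.BilinForm ℝ V, LinearMap.flip K = -K → ∀ x y, K y x = -K x y :=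
    fun K hK x y => LinearMap.congr_fun₂ hK x y
  have hflip' : ∀ K : LinearMap.BilinForm ℝ V, LinearMap.flip K = K → ∀ x y, K y x = K x y :=
    fun K hK x y => LinearMap.congr_fun₂ hK x y
  by_cases hi : i ∈ ({1, 2, 3, 4, 5, 6, 7, 8, 9} : Set ℕ)
  swap
  -- The family is indexed by all of `ℕ`: out of range the operator, and hence the subspace, is
  -- zero.
  · simp only [Set.mem_insert_iff, Set.mem_singleton_iff] at hi
    unfold component
    split <;> first | rfl | omega
  by_cases hj : j ∈ ({1, 2, 3, 4, 5, 6, 7, 8, 9} : Set ℕ)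
  swap
  · have h : L = 0 := by
      rw [mem_tensorSubspace] at hL
      rw [hL]
      simp only [Set.mem_insert_iff, Set.mem_singleton_iff] at hj
      unfold component
      split <;> first | rfl | omega
    rw [h]
    exact (S.tensorSubspace n i).zero_mem.symm
  simp only [Set.mem_insert_iff, Set.mem_singleton_iff] at hi hj
  by_cases hj6 : j ≤ 6
  · have hh := S.hPart_eq_of_mem_tensorSubspace
      (by simp only [Set.mem_insert_iff, Set.mem_singleton_iff]; omega) hL
    by_cases hi6 : 7 ≤ i
    · exact S.component_eq_zero_of_hPart_eq hh
        (by simp only [Set.mem_insert_iff, Set.mem_singleton_iff]; omega)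
    by_cases hj3 : j = 3 ∨ j = 6
    · have hφ := S.compφ_eq_neg_of_mem_tensorSubspace hj3 hL
      by_cases hi3 : i = 3 ∨ i = 6
      · rcases hj3 with rfl | rfl
        · have hs := S.flip_eq_of_mem_tensorSubspace (by simp) hL
          exact S.component_alternating_eq_zero (S.flip_hPart hs)
            (by simp only [Set.mem_insert_iff, Set.mem_singleton_iff]; omega)
        · have hs := S.flip_eq_neg_of_mem_tensorSubspace (by simp) hL
          exact S.component_eq_zero_of_flip_eq_neg hs
            (by simp only [Set.mem_insert_iff, Set.mem_singleton_iff]; omega)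
      · exact S.component_eq_zero_of_compφ_eq_neg hh hφ
          (by simp only [Set.mem_insert_iff, Set.mem_singleton_iff]; omega)
    · have hφ := S.compφ_eq_of_mem_tensorSubspace
        (by simp only [Set.mem_insert_iff, Set.mem_singleton_iff]; omega) hL
      have hφ' : ∀ x y, L (S.φ x) (S.φ y) = L x y := fun x y => LinearMap.congr_fun₂ hφ x y
      by_cases hi3 : i = 3 ∨ i = 6
      · exact S.component_three_six_eq_zero hh hφ hi3
      by_cases hj2 : j ≤ 2
      · have hs := S.flip_eq_of_mem_tensorSubspace
          (by simp only [Set.mem_insert_iff, Set.mem_singleton_iff]; omega) hL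
        by_cases hi2 : 4 ≤ i
        · exact S.component_alternating_eq_zero (S.flip_hPart hs)
            (by simp only [Set.mem_insert_iff, Set.mem_singleton_iff]; omega)
        · obtain ⟨rfl, rfl⟩ | ⟨rfl, rfl⟩ : i = 1 ∧ j = 2 ∨ i = 2 ∧ j = 1 := by omega
          · simp only [component, S.traceα_eq_zero_of_mem_two hn hL, zero_smul]
          · rw [mem_tensorSubspace] at hL
            refine LinearMap.ext₂ fun x y => ?_
            have h := LinearMap.congr_fun₂ hL x y
            simp only [component, LinearMap.smul_apply, smul_eq_mul] at h
            -- Here `L` equals its own trace term, and it is symmetric and `φ`-invariant, so `L₂(L)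
            -- = (L + L) / 2 - L`.
            simp [component, hh, symPart_apply, compφ_apply, hφ', hflip' L hs x y, ← h]
            ring
      · have hs := S.flip_eq_neg_of_mem_tensorSubspace
          (by simp only [Set.mem_insert_iff, Set.mem_singleton_iff]; omega) hL
        by_cases hi2 : i ≤ 2
        · exact S.component_eq_zero_of_flip_eq_neg hs
            (by simp only [Set.mem_insert_iff, Set.mem_singleton_iff]; omega)
        · obtain ⟨rfl, rfl⟩ | ⟨rfl, rfl⟩ : i = 4 ∧ j = 5 ∨ i = 5 ∧ j = 4 := by omega
          · simp only [component, S.traceβ_eq_zero_of_mem_five hn hL, neg_zero, zero_smul]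
          · rw [mem_tensorSubspace] at hL
            refine LinearMap.ext₂ fun x y => ?_
            have h := LinearMap.congr_fun₂ hL x y
            simp only [component, LinearMap.smul_apply, smul_eq_mul] at h
            simp only [component, hh, LinearMap.sub_apply, LinearMap.smul_apply, smul_eq_mul,
              LinearMap.add_apply, altPart_apply, compφ_apply, hφ', hflip L hs x y, ← h,
              LinearMap.zero_apply]
            ring
  · have hh := S.hPart_eq_zero_of_mem_tensorSubspace
      (by simp only [Set.mem_insert_iff, Set.mem_singleton_iff]; omega) hL
    by_cases hi6 : i ≤ 6
    · exact S.component_eq_zero_of_hPart_eq_zero hh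
        (by simp only [Set.mem_insert_iff, Set.mem_singleton_iff]; omega)
    by_cases hj8 : j = 8
    · subst hj8
      have hs := S.flip_eq_neg_of_mem_tensorSubspace (by simp) hL
      exact S.component_eq_zero_of_flip_eq_neg hs
        (by simp only [Set.mem_insert_iff, Set.mem_singleton_iff]; omega)
    · have hs := S.flip_eq_of_mem_tensorSubspace
        (by simp only [Set.mem_insert_iff, Set.mem_singleton_iff]; omega) hL
      by_cases hi8 : i = 8
      · subst hi8
        exact S.component_eight_eq_zero hs
      · obtain ⟨rfl, rfl⟩ | ⟨rfl, rfl⟩ : i = 7 ∧ j = 9 ∨ i = 9 ∧ j = 7 := by omega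
        · rw [mem_tensorSubspace] at hL
          have h : ∀ x y, L x y = S.η x * S.η y * L S.ξ S.ξ := fun x y =>
            (LinearMap.congr_fun₂ hL x y).trans (S.wPart_apply L x y)
          refine LinearMap.ext₂ fun x y => ?_
          simp only [component, symPart_apply, vPart_apply, h _ y, h x, h y, h _ x, S.η_ξ,
            LinearMap.zero_apply]
          ring
        · rw [mem_tensorSubspace] at hL
          -- At `(ξ, ξ)` the coefficients of `vL` add up to `1 + 1 - 2 = 0`.
          have h := LinearMap.congr_fun₂ hL S.ξ S.ξ
          simp only [component, symPart_apply, vPart_apply, S.η_ξ] at h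
          have h' : L S.ξ S.ξ = 0 := by linarith
          simp [component, wPart, h']

/-- The operator `Lᵢ` fixes its own subspace and kills all others, hence also their sum; a common
element is therefore zero. -/
theorem iSupIndep_tensorSubspace (hn : Module.finrank ℝ V = 2 * n + 1) :
    iSupIndep (fun j : ℕ => S.tensorSubspace n j) := by
  intro i
  rw [Submodule.disjoint_def]
  intro L hL hL'
  let P : LinearMap.BilinForm ℝ V →ₗ[ℝ] LinearMap.BilinForm ℝ V :=
    { toFun := S.component n i
      map_add' := S.component_add n i
      map_smul' := S.component_smul n i }
  have h : ⨆ j, ⨆ (_ : j ≠ i), S.tensorSubspace n j ≤ LinearMap.ker P :=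
    iSup₂_le fun j hj K hK => S.component_eq_zero_of_mem_tensorSubspace hn hj.symm hK
  rw [S.mem_tensorSubspace.1 hL]
  exact h hL'

/-! ### Sums of component subspaces -/

theorem flip_eq_of_mem_iSup (hL : L ∈ ⨆ j ∈ ({1, 2, 3, 7, 9} : Set ℕ), S.tensorSubspace n j) :
    LinearMap.flip L = L := by
  let P : Submodule ℝ (LinearMap.BilinForm ℝ V) :=
    { carrier := {K | LinearMap.flip K = K}
      add_mem' := by
        intro K K' hK hK'
        exact congrArg₂ (· + ·) hK hK'
      zero_mem' := rfl
      smul_mem' := by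
        intro c K hK
        exact congrArg (c • ·) hK }
  have h : ⨆ j ∈ ({1, 2, 3, 7, 9} : Set ℕ), S.tensorSubspace n j ≤ P :=
    iSup₂_le fun j hj K hK => S.flip_eq_of_mem_tensorSubspace hj hK
  exact h hL

theorem component_mem_tensorSubspace (hn : Module.finrank ℝ V = 2 * n + 1) {i : ℕ}
    (hi : i ∈ ({1, 2, 3, 7, 8, 9} : Set ℕ)) (L : LinearMap.BilinForm ℝ V) :
    S.component n i L ∈ S.tensorSubspace n i := by
  rw [mem_tensorSubspace]
  rcases hi with rfl | rfl | rfl | rfl | rfl | rfl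
  · rcases eq_or_ne n 0 with rfl | h0
    · simp [component]
    have h0' : (n : ℝ) ≠ 0 := Nat.cast_ne_zero.2 h0
    simp only [component, traceα_smul, S.traceα_hMetric hn]
    rw [div_mul_cancel₀ _ (by positivity)]
  · have h1 : S.traceα (S.component n 2 L) / (2 * n) = 0 := by
      rcases eq_or_ne n 0 with rfl | h0
      · simp
      have h0' : (n : ℝ) ≠ 0 := Nat.cast_ne_zero.2 h0
      simp only [component]
      rw [traceα_sub, traceα_smul, traceα_smul, traceα_add, traceα_compφ,
        traceα_symPart, traceα_hPart, S.traceα_hMetric hn, div_mul_cancel₀ _ (by positivity)]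
      ring
    have h2 : ∀ K, S.traceα K / (2 * n) = 0 → S.component n 2 K
        = (1 / 2 : ℝ) • (symPart (S.hPart K) + S.compφ (symPart (S.hPart K))) := by
      intro K hK
      refine LinearMap.ext₂ fun x y => ?_
      simp [component, hK]
    -- `L₂(L)` is already trace free, so a second application subtracts nothing; what remains is
    -- that the averaging is idempotent.
    rw [h2 _ h1]
    refine LinearMap.ext₂ fun x y => ?_
    simp [component, symPart_apply, compφ_apply, hPart_apply, hMap_hMap, hMap_φ, φ_hMap, S.φ_φ,
      hMap_ξ, hMetric_hMap, hMetric_φ_φ, S.hMetric_symm y x]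
    ring
  · refine LinearMap.ext₂ fun x y => ?_
    simp [component, symPart_apply, compφ_apply, hPart_apply, hMap_hMap, hMap_φ, φ_hMap, S.φ_φ,
      hMap_ξ]
    ring
  · refine LinearMap.ext₂ fun x y => ?_
    simp [component, symPart_apply, vPart_apply, S.η_ξ]
    ring
  · refine LinearMap.ext₂ fun x y => ?_
    simp [component, altPart_apply, vPart_apply, S.η_ξ]
    ring
  · refine LinearMap.ext₂ fun x y => ?_
    simp [component, wPart_apply, S.η_ξ]

/-- In `L = hL + vL + wL`, components 1, 2, 3 add up to the symmetric part of `hL`, components 7 and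
8 to `vL`, and 9 is `wL`. Only the alternating part of `hL` would be missing. -/
theorem sum_components (h : LinearMap.flip (S.hPart L) = S.hPart L) :
    L = S.component n 1 L + S.component n 2 L + S.component n 3 L + S.component n 7 L
      + S.component n 8 L + S.component n 9 L := by
  refine LinearMap.ext₂ fun x y => ?_
  have h1 := LinearMap.congr_fun₂ h x y
  simp [hPart_apply, hMap_apply] at h1
  simp [component, symPart_apply, altPart_apply, vPart_apply, wPart_apply, hPart_apply,
    hMap_apply]
  linarith

theorem mem_iSup_of_flip_hPart_eq (hn : Module.finrank ℝ V = 2 * n + 1)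
    (h : LinearMap.flip (S.hPart L) = S.hPart L) :
    L ∈ ⨆ j ∈ ({1, 2, 3, 7, 8, 9} : Set ℕ), S.tensorSubspace n j := by
  have hmem : ∀ i ∈ ({1, 2, 3, 7, 8, 9} : Set ℕ), S.component n i L ∈
      ⨆ j ∈ ({1, 2, 3, 7, 8, 9} : Set ℕ), S.tensorSubspace n j := fun i hi =>
    le_iSup₂ (f := fun j (_ : j ∈ ({1, 2, 3, 7, 8, 9} : Set ℕ)) => S.tensorSubspace n j) i hi
      (S.component_mem_tensorSubspace hn hi L)
  rw [S.sum_components (n := n) h]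
  refine add_mem (add_mem (add_mem (add_mem (add_mem ?_ ?_) ?_) ?_) ?_) ?_ <;>
  exact hmem _ (by simp)

theorem mem_iSup_of_flip_eq (hn : Module.finrank ℝ V = 2 * n + 1)
    (h : LinearMap.flip L = L) :
    L ∈ ⨆ j ∈ ({1, 2, 3, 7, 9} : Set ℕ), S.tensorSubspace n j := by
  have hmem : ∀ i ∈ ({1, 2, 3, 7, 9} : Set ℕ), S.component n i L ∈
      ⨆ j ∈ ({1, 2, 3, 7, 9} : Set ℕ), S.tensorSubspace n j := fun i hi =>
    le_iSup₂ (f := fun j (_ : j ∈ ({1, 2, 3, 7, 9} : Set ℕ)) => S.tensorSubspace n j) i hi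
      (S.component_mem_tensorSubspace hn
        (Set.insert_subset_insert (Set.insert_subset_insert (Set.insert_subset_insert
          (Set.insert_subset_insert (Set.subset_insert _ _)))) hi) L)
  rw [S.sum_components (n := n) (S.flip_hPart h), S.component_eight_eq_zero h, add_zero]
  refine add_mem (add_mem (add_mem (add_mem ?_ ?_) ?_) ?_) ?_ <;>
  exact hmem _ (by simp)

end Decomposition

end AlmostContactMetric

/-! ### Coordinate vector fields of a chart and their commuting derivatives. -/

section CoordinateFields

open Filter Topology VectorField

variable {E : Type*} [NormedAddCommGroup E] [NormedSpace ℝ E]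
  {M : Type*} [TopologicalSpace M] [ChartedSpace E M] [IsManifold 𝓘(ℝ, E) ∞ M]

theorem two_le_infty : (2 : WithTop ℕ∞) ≤ ∞ := WithTop.coe_le_coe.2 (le_top : (2 : ℕ∞) ≤ ⊤)

/-- The constant vector field `v` on the model space. -/
noncomputable def constField (v : E) : Π u : E, TangentSpace 𝓘(ℝ, E) u := fun _ => v

/-- The vector field with constant coefficients `v` in the preferred chart at `p`. -/
noncomputable def coordField (p : M) (v : E) : Π q : M, TangentSpace 𝓘(ℝ, E) q :=
  mpullback 𝓘(ℝ, E) 𝓘(ℝ, E) (extChartAt 𝓘(ℝ, E) p) (constField v)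

theorem contMDiff_constField (v : E) :
    ContMDiff 𝓘(ℝ, E) 𝓘(ℝ, E).tangent ∞ (T% (constField v)) :=
  fun _ => contMDiffAt_vectorSpace_iff_contDiffAt.2 contDiffAt_const

theorem mlieBracket_constField (v w : E) :
    mlieBracket 𝓘(ℝ, E) (constField v) (constField w) = 0 := by
  rw [← mlieBracketWithin_univ, mlieBracketWithin_eq_lieBracketWithin]
  ext u
  refine (congrFun (lieBracketWithin_univ (𝕜 := ℝ) (V := fun _ : E => v) (W := fun _ => w)) u).trans
    ?_
  have h1 : fderiv ℝ (fun _ : E => v) u = 0 := fderiv_const_apply v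
  have h2 : fderiv ℝ (fun _ : E => w) u = 0 := fderiv_const_apply w
  change fderiv ℝ (fun _ : E => w) u v - fderiv ℝ (fun _ : E => v) u w = 0
  rw [h1, h2]
  simp

theorem mfderiv_extChartAt_coordField {p q : M} (hq : q ∈ (extChartAt 𝓘(ℝ, E) p).source) (v : E) :
    mfderiv 𝓘(ℝ, E) 𝓘(ℝ, E) (extChartAt 𝓘(ℝ, E) p) q (coordField p v q) = v := by
  have : IsManifold 𝓘(ℝ, E) 1 M := IsManifold.of_le (n := ∞) (by simp)
  exact (isInvertible_mfderiv_extChartAt hq).self_apply_inverse v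

/-- Allows tensorial identities at `p` to be checked on coordinate fields, whose brackets vanish. -/
theorem exists_coordField_eq (p : M) (x : TangentSpace 𝓘(ℝ, E) p) :
    ∃ v : E, coordField p v p = x := by
  have : IsManifold 𝓘(ℝ, E) 1 M := IsManifold.of_le (n := ∞) (by simp)
  exact ⟨mfderiv 𝓘(ℝ, E) 𝓘(ℝ, E) (extChartAt 𝓘(ℝ, E) p) p x,
    (isInvertible_mfderiv_extChartAt (mem_extChartAt_source p)).inverse_apply_self x⟩

theorem contMDiffAt_coordField [CompleteSpace E] {p q : M}
    (hq : q ∈ (extChartAt 𝓘(ℝ, E) p).source) (v : E) :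
    ContMDiffAt 𝓘(ℝ, E) 𝓘(ℝ, E).tangent ∞ (T% (coordField p v)) q := by
  have : IsManifold 𝓘(ℝ, E) 1 M := IsManifold.of_le (n := ∞) (by simp)
  exact ContMDiffAt.mpullback_vectorField_preimage (n := ∞) (contMDiff_constField v _)
    (contMDiffAt_extChartAt' (by simpa using hq)) (isInvertible_mfderiv_extChartAt hq) (by simp)

theorem mdiffAt_coordField [CompleteSpace E] {p q : M}
    (hq : q ∈ (extChartAt 𝓘(ℝ, E) p).source) (v : E) : MDiffAt (T% (coordField p v)) q :=
  (contMDiffAt_coordField hq v).mdifferentiableAt (by simp)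

theorem mlieBracket_coordField [CompleteSpace E] {p q : M}
    (hq : q ∈ (extChartAt 𝓘(ℝ, E) p).source) (v w : E) :
    mlieBracket 𝓘(ℝ, E) (coordField p v) (coordField p w) q = 0 := by
  have : IsManifold 𝓘(ℝ, E) (minSmoothness ℝ 2) M := by
    rw [minSmoothness_of_isRCLikeNormedField]
    exact IsManifold.of_le (n := ∞) two_le_infty
  have h := mpullback_mlieBracket (I := 𝓘(ℝ, E)) (I' := 𝓘(ℝ, E)) (n := ∞)
    (f := extChartAt 𝓘(ℝ, E) p) (x₀ := q)
    ((contMDiff_constField v _).mdifferentiableAt (by simp))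
    ((contMDiff_constField w _).mdifferentiableAt (by simp))
    (contMDiffAt_extChartAt' (by simpa using hq))
    (by rw [minSmoothness_of_isRCLikeNormedField]; exact two_le_infty)
  rw [mlieBracket_constField, mpullback_zero] at h
  exact h.symm

theorem mvfderiv_coordField {p q : M} (hq : q ∈ (extChartAt 𝓘(ℝ, E) p).source) {f : M → ℝ}
    (hf : MDiffAt f q) (v : E) :
    mvfderiv 𝓘(ℝ, E) f q (coordField p v q)
      = fderiv ℝ (f ∘ (extChartAt 𝓘(ℝ, E) p).symm) (extChartAt 𝓘(ℝ, E) p q) v := by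
  have : IsManifold 𝓘(ℝ, E) 1 M := IsManifold.of_le (n := ∞) (by simp)
  set e := extChartAt 𝓘(ℝ, E) p with he
  have h1 : (f ∘ e.symm) ∘ e =ᶠ[𝓝 q] f := by
    filter_upwards [(isOpen_extChartAt_source (I := 𝓘(ℝ, E)) p).mem_nhds hq] with r hr
    exact congrArg f (e.left_inv hr)
  have h2 : MDiffAt (f ∘ e.symm) (e q) := by
    have h : MDiffAt e.symm (e q) := by
      have := mdifferentiableWithinAt_extChartAt_symm (I := 𝓘(ℝ, E)) (e.map_source hq)
      rwa [modelWithCornersSelf_coe, Set.range_id, mdifferentiableWithinAt_univ] at this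
    refine MDifferentiableAt.comp (I' := 𝓘(ℝ, E)) _ ?_ h
    rw [e.left_inv hq]
    exact hf
  have h3 : mvfderiv 𝓘(ℝ, E) f q (coordField p v q)
      = mvfderiv 𝓘(ℝ, E) ((f ∘ e.symm) ∘ e) q (coordField p v q) :=
    congrArg (fun l : E →L[ℝ] ℝ => l (coordField p v q)) h1.mfderiv_eq.symm
  rw [h3]
  refine (mvfderiv_comp_apply q h2 (mdifferentiableAt_extChartAt (by simpa [he] using hq)) _).trans
    ?_
  rw [mfderiv_extChartAt_coordField hq]
  exact congrArg (fun l : E →L[ℝ] ℝ => l v) mfderiv_eq_fderiv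

theorem contDiffAt_comp_extChartAt_symm {p : M} {f : M → ℝ}
    (hf : ContMDiffAt 𝓘(ℝ, E) 𝓘(ℝ, ℝ) ∞ f p) :
    ContDiffAt ℝ ∞ (f ∘ (extChartAt 𝓘(ℝ, E) p).symm) (extChartAt 𝓘(ℝ, E) p p) := by
  have h : ContMDiffAt 𝓘(ℝ, E) 𝓘(ℝ, E) ∞ (extChartAt 𝓘(ℝ, E) p).symm (extChartAt 𝓘(ℝ, E) p p) :=
    (contMDiffOn_extChartAt_symm p).contMDiffAt
      ((isOpen_extChartAt_target p).mem_nhds (mem_extChartAt_target p))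
  refine contMDiffAt_iff_contDiffAt.1 (ContMDiffAt.comp _ ?_ h)
  rw [extChartAt_to_inv]
  exact hf

theorem differentiableAt_fderiv_comp_extChartAt_symm {p : M} {f : M → ℝ}
    (hf : ContMDiffAt 𝓘(ℝ, E) 𝓘(ℝ, ℝ) ∞ f p) :
    DifferentiableAt ℝ (fderiv ℝ (f ∘ (extChartAt 𝓘(ℝ, E) p).symm))
      (extChartAt 𝓘(ℝ, E) p p) :=
  ((contDiffAt_comp_extChartAt_symm hf).fderiv_right (m := 1)
    (by rw [one_add_one_eq_two]; exact two_le_infty)).differentiableAt (by simp)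

theorem mvfderiv_coordField_eventuallyEq {p : M} {f : M → ℝ}
    (hf : ContMDiffAt 𝓘(ℝ, E) 𝓘(ℝ, ℝ) ∞ f p) (w : E) :
    (fun q => mvfderiv 𝓘(ℝ, E) f q (coordField p w q)) =ᶠ[𝓝 p]
      (fun u => fderiv ℝ (f ∘ (extChartAt 𝓘(ℝ, E) p).symm) u w) ∘ extChartAt 𝓘(ℝ, E) p := by
  have : IsManifold 𝓘(ℝ, E) 1 M := IsManifold.of_le (n := ∞) (by simp)
  have hev : ∀ᶠ q in 𝓝 p, MDiffAt f q := by
    have h := (contMDiffAt_iff_contMDiffAt_nhds (n := 1) (by simp)).1 (hf.of_le (by simp))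
    exact h.mono fun q hq => hq.mdifferentiableAt (by simp)
  filter_upwards [hev, (isOpen_extChartAt_source (I := 𝓘(ℝ, E)) p).mem_nhds
    (mem_extChartAt_source p)] with q hq hq'
  exact mvfderiv_coordField hq' hq w

theorem mdiffAt_mvfderiv_coordField {p : M} {f : M → ℝ}
    (hf : ContMDiffAt 𝓘(ℝ, E) 𝓘(ℝ, ℝ) ∞ f p) (w : E) :
    MDiffAt (fun q => mvfderiv 𝓘(ℝ, E) f q (coordField p w q)) p := by
  have : IsManifold 𝓘(ℝ, E) 1 M := IsManifold.of_le (n := ∞) (by simp)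
  refine MDifferentiableAt.congr_of_eventuallyEq ?_ (mvfderiv_coordField_eventuallyEq hf w)
  exact MDifferentiableAt.comp p
    ((differentiableAt_fderiv_comp_extChartAt_symm hf).clm_apply
      (differentiableAt_const w)).mdifferentiableAt
    (mdifferentiableAt_extChartAt (mem_chart_source E p))

theorem mvfderiv_congr {p : M} {f f' : M → ℝ} (h : f =ᶠ[𝓝 p] f') (x : TangentSpace 𝓘(ℝ, E) p) :
    mvfderiv 𝓘(ℝ, E) f p x = mvfderiv 𝓘(ℝ, E) f' p x :=
  congrArg (fun l : E →L[ℝ] ℝ => l x) h.mfderiv_eq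

theorem mvfderiv_mvfderiv_coordField {p : M} {f : M → ℝ}
    (hf : ContMDiffAt 𝓘(ℝ, E) 𝓘(ℝ, ℝ) ∞ f p) (v w : E) :
    mvfderiv 𝓘(ℝ, E) (fun q => mvfderiv 𝓘(ℝ, E) f q (coordField p w q)) p (coordField p v p)
      = fderiv ℝ (fderiv ℝ (f ∘ (extChartAt 𝓘(ℝ, E) p).symm)) (extChartAt 𝓘(ℝ, E) p p) v w := by
  have : IsManifold 𝓘(ℝ, E) 1 M := IsManifold.of_le (n := ∞) (by simp)
  have hd := differentiableAt_fderiv_comp_extChartAt_symm hf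
  have hd' := hd.clm_apply (differentiableAt_const (c := w))
  rw [mvfderiv_congr (mvfderiv_coordField_eventuallyEq hf w)]
  refine (mvfderiv_comp_apply p hd'.mdifferentiableAt
    (mdifferentiableAt_extChartAt (mem_chart_source E p)) _).trans ?_
  rw [mfderiv_extChartAt_coordField (mem_extChartAt_source p)]
  refine (congrArg (fun l : E →L[ℝ] ℝ => l v) mfderiv_eq_fderiv).trans ?_
  change fderiv ℝ (fun u => fderiv ℝ (f ∘ (extChartAt 𝓘(ℝ, E) p).symm) u w) _ v = _
  rw [fderiv_clm_apply hd (differentiableAt_const _)]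
  simp

/-- In the chart both sides are second derivatives of the local expression of `f`, which are
symmetric. This is the source of `d² = 0` below. -/
theorem mvfderiv_mvfderiv_coordField_comm {p : M} {f : M → ℝ}
    (hf : ContMDiffAt 𝓘(ℝ, E) 𝓘(ℝ, ℝ) ∞ f p) (v w : E) :
    mvfderiv 𝓘(ℝ, E) (fun q => mvfderiv 𝓘(ℝ, E) f q (coordField p w q)) p (coordField p v p)
      = mvfderiv 𝓘(ℝ, E) (fun q => mvfderiv 𝓘(ℝ, E) f q (coordField p v q)) p
        (coordField p w p) := by
  rw [mvfderiv_mvfderiv_coordField hf, mvfderiv_mvfderiv_coordField hf]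
  exact ((contDiffAt_comp_extChartAt_symm hf).isSymmSndFDerivAt
    (by rw [minSmoothness_of_isRCLikeNormedField]; exact two_le_infty)) v w

end CoordinateFields

/-! ### Exterior derivatives through a torsion-free connection. -/

section Forms

open Filter Topology VectorField

variable {E : Type*} [NormedAddCommGroup E] [NormedSpace ℝ E]
  {M : Type*} [TopologicalSpace M] [ChartedSpace E M] [IsManifold 𝓘(ℝ, E) ∞ M]

theorem FormField.IsOneForm.diffAt {θ : FormField E M} (hθ : θ.IsOneForm) (p : M) : θ.DiffAt p :=
  (hθ p).mdifferentiableAt (by simp)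

theorem FormField.IsOneForm.contMDiffAt_apply {θ : FormField E M} (hθ : θ.IsOneForm) {p : M}
    {X : Π q : M, TangentSpace 𝓘(ℝ, E) q}
    (hX : ContMDiffAt 𝓘(ℝ, E) 𝓘(ℝ, E).tangent ∞ (T% X) p) :
    ContMDiffAt 𝓘(ℝ, E) 𝓘(ℝ, ℝ) ∞ (fun q => θ q (X q)) p := by
  have h : ContMDiffAt 𝓘(ℝ, E) (𝓘(ℝ, E).prod 𝓘(ℝ, ℝ)) ∞
      (fun q => TotalSpace.mk' ℝ (E := Bundle.Trivial M ℝ) q (θ q (X q))) p :=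
    ContMDiffAt.clm_bundle_apply (F₁ := E) (hθ p) hX
  simp only [contMDiffAt_totalSpace] at h
  exact h.2

theorem FormField.IsOneForm.contMDiffAt_coordField [CompleteSpace E] {θ : FormField E M}
    (hθ : θ.IsOneForm) (p : M) (v : E) :
    ContMDiffAt 𝓘(ℝ, E) 𝓘(ℝ, ℝ) ∞ (fun q => θ q (coordField p v q)) p :=
  hθ.contMDiffAt_apply (_root_.contMDiffAt_coordField (mem_extChartAt_source p) v)

theorem FormField.IsOneForm.const_smul {θ : FormField E M} (hθ : θ.IsOneForm) (c : ℝ) :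
    FormField.IsOneForm (fun p => c • θ p : FormField E M) :=
  ContMDiff.const_smul_section hθ

variable [FiniteDimensional ℝ E]

/-- Zero torsion replaces `∇_X Y - ∇_Y X` by `[X, Y]`; the right side is `dθ(X, Y)`. -/
theorem nablaForm_sub_flip {nabla : Connection E M} (hnabla : nabla.torsion = 0)
    {θ : FormField E M} {p : M} (hθ : θ.DiffAt p) {X Y : Π q : M, TangentSpace 𝓘(ℝ, E) q}
    (hX : MDiffAt (T% X) p) (hY : MDiffAt (T% Y) p) :
    nablaForm nabla θ p (X p) (Y p) - nablaForm nabla θ p (Y p) (X p)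
      = mvfderiv 𝓘(ℝ, E) (fun q => θ q (Y q)) p (X p)
        - mvfderiv 𝓘(ℝ, E) (fun q => θ q (X q)) p (Y p) - θ p (mlieBracket 𝓘(ℝ, E) X Y p) := by
  have : CompleteSpace E := FiniteDimensional.complete ℝ E
  have h := nabla.torsion_apply hX hY
  rw [hnabla] at h
  have h' : mlieBracket 𝓘(ℝ, E) X Y p = nabla Y p (X p) - nabla X p (Y p) :=
    (sub_eq_zero.1 h.symm).symm
  rw [nablaForm_apply nabla θ p hθ Y hY, nablaForm_apply nabla θ p hθ X hX, h', map_sub]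
  ring

/-- For a torsion-free connection, a 1-form is closed if and only if its covariant derivative is
symmetric. -/
theorem FormField.IsOneForm.isClosedForm_iff {nabla : Connection E M} (hnabla : nabla.torsion = 0)
    {θ : FormField E M} (hθ : θ.IsOneForm) :
    θ.IsClosedForm ↔ ∀ p, LinearMap.flip (nablaForm nabla θ p) = nablaForm nabla θ p := by
  have : CompleteSpace E := FiniteDimensional.complete ℝ E
  constructor
  · intro h p
    refine LinearMap.ext₂ fun x y => ?_
    obtain ⟨v, rfl⟩ := exists_coordField_eq p x
    obtain ⟨w, rfl⟩ := exists_coordField_eq p y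
    have hX := mdiffAt_coordField (mem_extChartAt_source (I := 𝓘(ℝ, E)) p) v
    have hY := mdiffAt_coordField (mem_extChartAt_source (I := 𝓘(ℝ, E)) p) w
    have h' := nablaForm_sub_flip hnabla (hθ.diffAt p) hX hY
    rw [h p _ _ hX hY] at h'
    exact (sub_eq_zero.1 h').symm
  · intro h p X Y hX hY
    rw [← nablaForm_sub_flip hnabla (hθ.diffAt p) hX hY, sub_eq_zero]
    exact LinearMap.congr_fun₂ (h p) (Y p) (X p)

theorem mvfderiv_add_const_mul_mul_sub_mul {p : M} {f a b c d : M → ℝ} {κ : ℝ} (hf : MDiffAt f p)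
    (ha : MDiffAt a p) (hb : MDiffAt b p) (hc : MDiffAt c p) (hd : MDiffAt d p)
    (x : TangentSpace 𝓘(ℝ, E) p) :
    mvfderiv 𝓘(ℝ, E) (fun q => f q + κ * (a q * b q - c q * d q)) p x
      = mvfderiv 𝓘(ℝ, E) f p x + κ * (a p * mvfderiv 𝓘(ℝ, E) b p x
        + b p * mvfderiv 𝓘(ℝ, E) a p x - c p * mvfderiv 𝓘(ℝ, E) d p x
        - d p * mvfderiv 𝓘(ℝ, E) c p x) := by
  have h1 : MDiffAt (fun q => a q * b q) p := ha.mul hb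
  have h2 : MDiffAt (fun q => c q * d q) p := hc.mul hd
  have h3 : MDiffAt (fun q => a q * b q - c q * d q) p := h1.sub h2
  have h4 : MDiffAt (fun _ : M => κ) p := mdifferentiableAt_const
  have h5 : MDiffAt (fun q => κ * (a q * b q - c q * d q)) p := h4.mul h3
  rw [mvfderiv_fun_add hf h5, mvfderiv_fun_mul h4 h3, mvfderiv_fun_sub h1 h2,
    mvfderiv_fun_mul ha hb, mvfderiv_fun_mul hc hd, mvfderiv_const]
  simp [-mul_eq_mul_left_iff]
  ring

/-- If `dη = κ θ ∧ η` with `κ ≠ 0`, then `dθ` vanishes on the kernel of `η` wherever `η` does not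
vanish. -/
theorem nablaForm_comm_of_mem_ker {nabla : Connection E M} (hnabla : nabla.torsion = 0)
    {η θ : FormField E M} (hη : η.IsOneForm) (hθ : θ.IsOneForm) {κ : ℝ} (hκ : κ ≠ 0)
    (hd : ∀ (p : M) (x y : TangentSpace 𝓘(ℝ, E) p),
      nablaForm nabla η p x y - nablaForm nabla η p y x = κ * (θ p x * η p y - θ p y * η p x))
    {p : M} {x y z : TangentSpace 𝓘(ℝ, E) p} (hx : η p x = 0) (hy : η p y = 0)
    (hz : η p z ≠ 0) : nablaForm nabla θ p x y = nablaForm nabla θ p y x := by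
  have : CompleteSpace E := FiniteDimensional.complete ℝ E
  -- The equation `dη = κ θ ∧ η` on the coordinate fields `v`, `w` holds throughout the chart
  -- domain, so it may be differentiated along `u`.
  have hdd : ∀ (v w u : E),
      mvfderiv 𝓘(ℝ, E) (fun q => mvfderiv 𝓘(ℝ, E) (fun r => η r (coordField p w r)) q
          (coordField p v q)) p (coordField p u p)
        - mvfderiv 𝓘(ℝ, E) (fun q => mvfderiv 𝓘(ℝ, E) (fun r => η r (coordField p v r)) q
          (coordField p w q)) p (coordField p u p)
      = κ * (θ p (coordField p v p)
            * mvfderiv 𝓘(ℝ, E) (fun r => η r (coordField p w r)) p (coordField p u p)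
          + η p (coordField p w p)
            * mvfderiv 𝓘(ℝ, E) (fun r => θ r (coordField p v r)) p (coordField p u p)
          - θ p (coordField p w p)
            * mvfderiv 𝓘(ℝ, E) (fun r => η r (coordField p v r)) p (coordField p u p)
          - η p (coordField p v p)
            * mvfderiv 𝓘(ℝ, E) (fun r => θ r (coordField p w r)) p (coordField p u p)) := by
    intro v w u
    have hη' : ∀ v, MDiffAt (fun q => η q (coordField p v q)) p := fun v =>
      (hη.contMDiffAt_coordField p v).mdifferentiableAt (by simp)
    have hθ' : ∀ v, MDiffAt (fun q => θ q (coordField p v q)) p := fun v =>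
      (hθ.contMDiffAt_coordField p v).mdifferentiableAt (by simp)
    have hev : (fun q => mvfderiv 𝓘(ℝ, E) (fun r => η r (coordField p w r)) q (coordField p v q))
        =ᶠ[𝓝 p] (fun q => mvfderiv 𝓘(ℝ, E) (fun r => η r (coordField p v r)) q (coordField p w q)
          + κ * (θ q (coordField p v q) * η q (coordField p w q)
            - θ q (coordField p w q) * η q (coordField p v q))) := by
      filter_upwards [(isOpen_extChartAt_source (I := 𝓘(ℝ, E)) p).mem_nhds
        (mem_extChartAt_source p)] with q hq
      have h := nablaForm_sub_flip hnabla (hη.diffAt q) (mdiffAt_coordField hq v)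
        (mdiffAt_coordField hq w)
      rw [mlieBracket_coordField hq, map_zero, sub_zero, hd] at h
      linarith
    rw [mvfderiv_congr hev, mvfderiv_add_const_mul_mul_sub_mul
      (mdiffAt_mvfderiv_coordField (hη.contMDiffAt_coordField p v) w) (hθ' v) (hη' w) (hθ' w)
      (hη' v)]
    ring
  obtain ⟨v, rfl⟩ := exists_coordField_eq p x
  obtain ⟨w, rfl⟩ := exists_coordField_eq p y
  obtain ⟨u, rfl⟩ := exists_coordField_eq p z
  have hcomm := fun v w u : E =>
    mvfderiv_mvfderiv_coordField_comm (hη.contMDiffAt_coordField p v) w u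
  have h := nablaForm_sub_flip hnabla (hθ.diffAt p)
    (mdiffAt_coordField (mem_extChartAt_source p) v)
    (mdiffAt_coordField (mem_extChartAt_source p) w)
  rw [mlieBracket_coordField (mem_extChartAt_source p), map_zero, sub_zero] at h
  have h0 := nablaForm_sub_flip hnabla (hη.diffAt p)
    (mdiffAt_coordField (mem_extChartAt_source p) v)
    (mdiffAt_coordField (mem_extChartAt_source p) w)
  have h0' := nablaForm_sub_flip hnabla (hη.diffAt p)
    (mdiffAt_coordField (mem_extChartAt_source p) w)
    (mdiffAt_coordField (mem_extChartAt_source p) u)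
  have h0'' := nablaForm_sub_flip hnabla (hη.diffAt p)
    (mdiffAt_coordField (mem_extChartAt_source p) u)
    (mdiffAt_coordField (mem_extChartAt_source p) v)
  rw [mlieBracket_coordField (mem_extChartAt_source p), map_zero, sub_zero, hd, hx, hy] at h0
  rw [mlieBracket_coordField (mem_extChartAt_source p), map_zero, sub_zero, hd, hy] at h0'
  rw [mlieBracket_coordField (mem_extChartAt_source p), map_zero, sub_zero, hd, hx] at h0''
  have e1 := hdd v w u
  have e2 := hdd w u v
  have e3 := hdd u v w
  rw [hx, hy] at e1
  rw [hy] at e2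
  rw [hx] at e3
  rw [← sub_eq_zero, h]
  refine (mul_eq_zero.1 ?_).resolve_left (mul_ne_zero hκ hz)
  have c1 := hcomm v w u
  have c2 := hcomm w u v
  have c3 := hcomm u v w
  -- In the cyclic sum of the differentiated equations the second derivatives of `η` cancel (`d²η =
  -- 0`). The terms `θ ∧ dη` disappear on inserting `dη = κ θ ∧ η`, because `θ ∧ θ = 0`; what is
  -- left is `κ η(z) dθ(x, y) = 0`.
  linear_combination -(e1 + e2 + e3) + c1 + c2 + c3 - κ * θ p (coordField p v p) * h0'
    - κ * θ p (coordField p w p) * h0'' - κ * θ p (coordField p u p) * h0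

end Forms

/-! ### The tensor `F`, the form `η` and the Lee form on `W₁`. -/

namespace AlmostContactMetricStructure

open Filter Topology VectorField

variable {E : Type*} [NormedAddCommGroup E] [NormedSpace ℝ E]
  {M : Type*} [TopologicalSpace M] [ChartedSpace E M] [IsManifold 𝓘(ℝ, E) ∞ M]
  [FiniteDimensional ℝ E] (S : AlmostContactMetricStructure E M) {nabla : Connection E M}

theorem g_ξ_left (p : M) (x : TangentSpace 𝓘(ℝ, E) p) : S.g.inner p (S.ξ p) x = S.η p x :=
  (S.fiber p).g_ξ_left x

theorem η_ξ (p : M) : S.η p (S.ξ p) = 1 := (S.fiber p).η_ξ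

theorem mdiffAt_ξ (p : M) : MDiffAt (T% S.ξ) p := (S.ξ_smooth p).mdifferentiableAt (by simp)

theorem exists_extension (p : M) (x : TangentSpace 𝓘(ℝ, E) p) :
    ∃ X : Π q : M, TangentSpace 𝓘(ℝ, E) q, MDiffAt (T% X) p ∧ X p = x := by
  have : CompleteSpace E := FiniteDimensional.complete ℝ E
  obtain ⟨v, hv⟩ := exists_coordField_eq p x
  exact ⟨_, mdiffAt_coordField (mem_extChartAt_source p) v, hv⟩

/-- `(∇_x η)(y) = g(∇_x ξ, y)`. -/
theorem nablaForm_η (hnabla : IsLeviCivita S.g nabla) (p : M) (x y : TangentSpace 𝓘(ℝ, E) p) :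
    nablaForm nabla S.η p x y = S.g.inner p (nabla S.ξ p x) y := by
  obtain ⟨Y, hY, rfl⟩ := exists_extension p y
  have h := hnabla.metric p S.ξ Y (S.mdiffAt_ξ p) hY x
  simp only [g_ξ_left] at h
  rw [nablaForm_apply nabla S.η p (S.η_smooth.diffAt p) Y hY, h]
  ring

/-- Since `φ ξ = 0`, the function `Φ(Y, ξ)` and the term `Φ(∇_x Y, ξ)` vanish; only `Φ(Y, ∇_x ξ)`
survives. -/
theorem F_ξ_right (p : M) (x y : TangentSpace 𝓘(ℝ, E) p) :
    S.F nabla p x y (S.ξ p) = S.g.inner p y (S.φ p (nabla S.ξ p x)) := by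
  obtain ⟨Y, hY, rfl⟩ := exists_extension p y
  rw [S.F_apply nabla p Y S.ξ hY (S.mdiffAt_ξ p)]
  simp [fundForm, S.φ_ξ, mvfderiv_const]

theorem F_swap (p : M) (x y z : TangentSpace 𝓘(ℝ, E) p) :
    S.F nabla p x y z = -S.F nabla p x z y := by
  obtain ⟨Y, hY, rfl⟩ := exists_extension p y
  obtain ⟨Z, hZ, rfl⟩ := exists_extension p z
  have h : ∀ (q : M) (u v : TangentSpace 𝓘(ℝ, E) q), S.fundForm q u v = -S.fundForm q v u := by
    intro q u v
    have h1 : S.g.inner q (S.φ q v) u = -S.g.inner q v (S.φ q u) := (S.fiber q).g_φ_left v u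
    rw [fundForm, S.g.symm, h1, fundForm]
  have h2 : (fun q => S.fundForm q (Y q) (Z q)) = -(fun q => S.fundForm q (Z q) (Y q)) :=
    funext fun q => h q _ _
  rw [S.F_apply nabla p Y Z hY hZ, S.F_apply nabla p Z Y hZ hY, h2, mvfderiv_neg,
    h p (nabla Y p x), h p (Y p)]
  simp
  ring

theorem g_nabla_ξ_ξ (hnabla : IsLeviCivita S.g nabla) (p : M) (x : TangentSpace 𝓘(ℝ, E) p) :
    S.η p (nabla S.ξ p x) = 0 := by
  have h := hnabla.metric p S.ξ S.ξ (S.mdiffAt_ξ p) (S.mdiffAt_ξ p) x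
  simp only [S.g_ξ_ξ, mvfderiv_const] at h
  rw [S.g.symm p _ (S.ξ p), g_ξ_left] at h
  simp at h
  linarith

/-- The bridge from `F` to `dη`: the value is `g(φ y, φ ∇_x ξ)`, and `∇_x ξ` is orthogonal to `ξ`.
-/
theorem F_φ_ξ (hnabla : IsLeviCivita S.g nabla) (p : M) (x y : TangentSpace 𝓘(ℝ, E) p) :
    S.F nabla p x (S.φ p y) (S.ξ p) = nablaForm nabla S.η p x y := by
  rw [F_ξ_right, S.g_φ_φ, S.g_nabla_ξ_ξ hnabla, S.nablaForm_η hnabla, S.g.symm]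
  simp

theorem ωForm_apply (p : M) (z : TangentSpace 𝓘(ℝ, E) p) :
    S.ωForm nabla p z = S.F nabla p (S.ξ p) (S.ξ p) z := rfl

theorem ωForm_φ (hnabla : IsLeviCivita S.g nabla) (p : M) (y : TangentSpace 𝓘(ℝ, E) p) :
    S.ωForm nabla p (S.φ p y) = -S.g.inner p (nabla S.ξ p (S.ξ p)) y := by
  rw [ωForm_apply, F_swap, F_φ_ξ S hnabla, S.nablaForm_η hnabla]

/-- The 1-form `ω ∘ φ`. -/
noncomputable def ωφForm (nabla : Connection E M) : FormField E M := fun p => S.ωForm nabla p ∘L S.φ p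

theorem ωφForm_apply (p : M) (y : TangentSpace 𝓘(ℝ, E) p) :
    S.ωφForm nabla p y = S.ωForm nabla p (S.φ p y) := rfl

/-- Smoothness is read off from `ω ∘ φ = -g(∇_ξ ξ, ·)`, which avoids proving that `F` is smooth. -/
theorem isOneForm_ωφForm (hnabla : IsLeviCivita S.g nabla) : (S.ωφForm nabla).IsOneForm := by
  have h1 : S.ωφForm nabla = fun p => (-1 : ℝ) • S.g.inner p (nabla S.ξ p (S.ξ p)) := by
    funext p
    refine ContinuousLinearMap.ext fun y => ?_
    rw [ωφForm_apply, S.ωForm_φ hnabla]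
    simp
  have h2 : ContMDiff 𝓘(ℝ, E) 𝓘(ℝ, E).tangent ∞ (T% (fun p => nabla S.ξ p (S.ξ p))) := by
    have h := hnabla.smooth.contMDiff.contMDiff (σ := S.ξ) (S.ξ_smooth.contMDiffOn)
    exact ContMDiff.clm_bundle_apply (F₁ := E) (F₂ := E) (contMDiffOn_univ.1 h) S.ξ_smooth
  have h3 : FormField.IsOneForm (fun p => S.g.inner p (nabla S.ξ p (S.ξ p)) : FormField E M) :=
    ContMDiff.clm_bundle_apply (F₁ := E) (F₂ := E →L[ℝ] ℝ) S.g.contMDiff h2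
  rw [h1]
  exact h3.const_smul (-1)

/-- Skew-symmetrizing yields `dη = (ω ∘ φ) ∧ η`, the only consequence of the `W₁` condition needed
besides the shape of the Lee form. -/
theorem InW₁.nablaForm_η {S : AlmostContactMetricStructure E M} (h : S.InW₁ nabla)
    (hnabla : IsLeviCivita S.g nabla) (p : M) (x y : TangentSpace 𝓘(ℝ, E) p) :
    nablaForm nabla S.η p x y = -(S.η p x * S.ωφForm nabla p y) := by
  rw [← F_φ_ξ S hnabla, h, S.η_φ, S.η_ξ, ωφForm_apply]
  ring

/-- On `W₁` both traces are traces of rank-one forms: `f*(ξ) = -ω(φ ξ) = 0`, and `f = ω` on `ker η`,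
which contains the image of `φ`. -/
theorem InW₁.leeForm_eq {S : AlmostContactMetricStructure E M} (h : S.InW₁ nabla) (n : ℕ) :
    S.leeForm nabla n = fun p => (1 / (2 * ((n : ℝ) - 1))) • S.ωφForm nabla p := by
  have hω : ∀ p, S.ωForm nabla p (S.ξ p) = 0 := fun p => by
    rw [ωForm_apply, h]
    ring
  have hη : ∀ p x, (S.fiber p).g (S.ξ p) x = (S.fiber p).η x := fun p => (S.fiber p).g_ξ_left
  funext p
  have h1 : S.fStarForm nabla p (S.ξ p) = 0 := by
    have h2 : (S.FBilin nabla p (S.ξ p)).compl₂ (S.fiber p).φ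
        = LinearMap.flip
          ((-((S.ωForm nabla p).toLinearMap ∘ₗ (S.fiber p).φ)).smulRight (S.fiber p).η) := by
      refine LinearMap.ext₂ fun x y => ?_
      refine (h p x (S.φ p y) (S.ξ p)).trans ?_
      rw [hω, S.η_ξ]
      simp [fiber, mul_comm]
    refine (congrArg (S.fiber p).metricTrace h2).trans ?_
    rw [AlmostContactMetric.metricTrace_flip, (S.fiber p).metricTrace_smulRight _ _ (hη p)]
    simp [fiber, S.φ_ξ]
  have h2 : ∀ z, S.η p z = 0 → S.fForm nabla p z = S.ωForm nabla p z := by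
    intro z hz
    have h3 : S.FBilin nabla p z
        = (S.fiber p).η.smulRight (S.ωForm nabla p z • (S.fiber p).η) := by
      refine LinearMap.ext₂ fun x y => ?_
      refine (h p x y z).trans ?_
      rw [hz]
      simp [fiber, mul_comm]
    have h4 := (S.fiber p).metricTrace_smulRight (S.fiber p).η (S.ωForm nabla p z • (S.fiber p).η)
      (v := S.ωForm nabla p z • S.ξ p) (by intro x; simp [hη])
    refine (congrArg (S.fiber p).metricTrace h3).trans (h4.trans ?_)
    rw [map_smul]
    have := S.η_ξ p
    simp [fiber, this]
  refine ContinuousLinearMap.ext fun z => ?_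
  simp [leeForm, h1, ωφForm_apply, h2 _ (S.η_φ p z)]

theorem IsLeeForm.exists_eq_smul {S : AlmostContactMetricStructure E M} {n : ℕ}
    {θ : FormField E M} (hθ : S.IsLeeForm nabla n θ) (h : S.InW₁ nabla) :
    ∃ c : ℝ, c ≠ 0 ∧ θ = fun p => c • S.ωφForm nabla p := by
  rcases hθ with ⟨hn, rfl⟩ | rfl
  · refine ⟨_, ?_, h.leeForm_eq n⟩
    -- Needed for the factor `1 / (2 (n - 1))` to be nonzero; at `n = 1` it would be zero by
    -- convention.
    have : (2 : ℝ) ≤ n := by exact_mod_cast hn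
    have : (n : ℝ) - 1 ≠ 0 := by linarith
    positivity
  · exact ⟨1, one_ne_zero, funext fun p => (one_smul ℝ _).symm⟩

theorem InW₁.isOneForm {S : AlmostContactMetricStructure E M} (h : S.InW₁ nabla)
    (hnabla : IsLeviCivita S.g nabla) {n : ℕ} {θ : FormField E M} (hθ : S.IsLeeForm nabla n θ) :
    θ.IsOneForm := by
  obtain ⟨c, -, rfl⟩ := hθ.exists_eq_smul h
  exact (S.isOneForm_ωφForm hnabla).const_smul c

/-- The map `h` takes values in `ker η`, where `dθ` vanishes. With `θ = c (ω ∘ φ)` the constant in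
`dη = κ θ ∧ η` is `c⁻¹`, and `ξ` is the vector off the kernel. -/
theorem InW₁.flip_hPart_nablaForm {S : AlmostContactMetricStructure E M} (h : S.InW₁ nabla)
    (hnabla : IsLeviCivita S.g nabla) {n : ℕ} {θ : FormField E M} (hθ : S.IsLeeForm nabla n θ)
    (p : M) : LinearMap.flip ((S.fiber p).hPart (nablaForm nabla θ p))
      = (S.fiber p).hPart (nablaForm nabla θ p) := by
  have hone := h.isOneForm hnabla hθ
  obtain ⟨c, hc, rfl⟩ := hθ.exists_eq_smul h
  refine LinearMap.ext₂ fun x y => ?_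
  refine nablaForm_comm_of_mem_ker hnabla.torsion S.η_smooth hone (inv_ne_zero hc) ?_
    ((S.fiber p).η_hMap y) ((S.fiber p).η_hMap x) (z := S.ξ p) (by simp [S.η_ξ])
  intro q u v
  rw [h.nablaForm_η hnabla, h.nablaForm_η hnabla]
  simp
  field_simp
  ring

end AlmostContactMetricStructure

/-! ### The theorem. -/

theorem theorem2 {E : Type*} [NormedAddCommGroup E] [NormedSpace ℝ E] [FiniteDimensional ℝ E]
    (n : ℕ) (hdim : Module.finrank ℝ E = 2 * n + 1)
    {M : Type*} [TopologicalSpace M] [T2Space M] [SecondCountableTopology M]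
    [ChartedSpace E M] [IsManifold 𝓘(ℝ, E) ∞ M]
    (S : AlmostContactMetricStructure E M)
    (nabla : Connection E M) (hnabla : IsLeviCivita S.g nabla)
    (θ : FormField E M) (hθ : S.IsLeeForm nabla n θ) :
    (∀ p : M, iSupIndep (fun j : ℕ => (S.fiber p).tensorSubspace n j)) ∧
    (S.InW₁ nabla ↔ S.InW₁Sum nabla n {1, 2, 3, 7, 8, 9} θ) ∧
    (S.InW₁Closed nabla θ ↔ S.InW₁Sum nabla n {1, 2, 3, 7, 9} θ) := by
  have hdim' : ∀ p : M, Module.finrank ℝ (TangentSpace 𝓘(ℝ, E) p) = 2 * n + 1 := fun _ => hdim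
  refine ⟨fun p => (S.fiber p).iSupIndep_tensorSubspace (hdim' p),
    ⟨fun h => ⟨h, h.isOneForm hnabla hθ, fun p => (S.fiber p).mem_iSup_of_flip_hPart_eq (hdim' p)
      (h.flip_hPart_nablaForm hnabla hθ p)⟩, fun h => h.1⟩, ?_, ?_⟩
  · rintro ⟨h, hone, hclosed⟩
    exact ⟨h, hone, fun p => (S.fiber p).mem_iSup_of_flip_eq (hdim' p)
      ((hone.isClosedForm_iff hnabla.torsion).1 hclosed p)⟩
  · rintro ⟨h, hone, hmem⟩
    exact ⟨h, hone, (hone.isClosedForm_iff hnabla.torsion).2 fun p =>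
      (S.fiber p).flip_eq_of_mem_iSup (hmem p)⟩
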